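/- Let $A$ be an associative unital ring. Write $\operatorname{mod}A$ for the category of finitely presented right $A$-modules, $\operatorname{proj}A$ for the category of finitely generated projective right $A$-modules and $\operatorname{Proj}A$ for the category of all projective right $A$-modules. Assume that $A$ is right coherent, that is, that $\operatorname{mod}A$ is abelian. Let $\mathbf D^b(\operatorname{mod}A)$ be the bounded derived category of $\operatorname{mod}A$, let $\mathbf D^b(\operatorname{proj}A)=\mathbf K^b(\operatorname{proj}A)$, let $f\colon\mathbf D^b(\operatorname{proj}A)\to\mathbf D^b(\operatorname{mod}A)$ be the functor induced by the inclusion $\operatorname{proj}A\subseteq\operatorname{mod}A$, and let $\mathbf K^{-,b}(\operatorname{proj}A)\subseteq\mathbf K(\operatorname{proj}A)$ be the full subcategory of the complexes which are bounded above and have bounded cohomology. For a category $\mathcal C$, a sequence $X_0\to X_1\to X_2\to\cdots$ in $\mathcal C$ is a *Cauchy sequence* if for every $C\in\mathcal C$ there is $n_C$ such that $\operatorname{Hom}(C,X_i)\to\operatorname{Hom}(C,X_j)$ is bijective for all $j\ge i\ge n_C$. A morphism $X\to Y$ of sequences is *eventually invertible* if for every $C\in\mathcal C$ there is $n_C$ such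 that $\operatorname{Hom}(C,X_i)\to\operatorname{Hom}(C,Y_i)$ is bijective for all $i\ge n_C$. The *sequential Cauchy completion* $\operatorname{Ind}_{\mathrm{Cau}}\mathcal C$ is obtained from the category of Cauchy sequences by formally inverting the eventually invertible morphisms. If $\mathcal C$ is triangulated, $\operatorname{Coh}\mathcal C$ denotes the category of cohomological functors $\mathcal C^{\mathrm{op}}\to\mathrm{Ab}$. Then the following hold. 1. The functor $f$ is a *Cauchy sequential partial completion*: $f$ is exact and fully faithful, the restricted Yoneda functor $$\mathbf D^b(\operatorname{mod}A)\longrightarrow\operatorname{Coh}\mathbf D^b(\operatorname{proj}A),\qquad X\mapsto \operatorname{Hom}(-,X)\circ f,$$ is fully faithful, and it factors, up to isomorphism, through the functor that is induced on $\operatorname{Ind}_{\mathrm{Cau}}\mathbf D^b(\operatorname{proj}A)$ by $(X_i)_i\mapsto\operatorname{colim}_i\operatorname{Hom}(-,X_i)$. 2. The functor $\mathbf K^{-,b}(\operatorname{proj}A)\to\mathbf D^b(\operatorname{mod}A)$ induced by the inclusion $\operatorname{proj}A\subseteq\operatorname{mod}A$ is an equivalence. For each complex $P$ of finitely generated projective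 modules which is bounded above and has bounded cohomology, the brutal truncations $$\sigma_{\ge 0}P\longrightarrow\sigma_{\ge -1}P\longrightarrow\sigma_{\ge -2}P\longrightarrow\cdots$$ form a Cauchy sequence in $\mathbf K^b(\operatorname{proj}A)$, and $P$, with the canonical morphisms $\sigma_{\ge -n}P\to P$, is its homotopy colimit in $\mathbf K(\operatorname{Proj}A)$: the coproduct $\coprod_{n\ge 0}\sigma_{\ge -n}P$ exists in $\mathbf K(\operatorname{Proj}A)$ and there is an exact triangle $$\coprod_{n\ge 0}\sigma_{\ge -n}P\xrightarrow{\ \mathrm{id}-\phi\ }\coprod_{n\ge 0}\sigma_{\ge -n}P\longrightarrow P\longrightarrow\Sigma\Bigl(\coprod_{n\ge 0}\sigma_{\ge -n}P\Bigr)$$ in which $\phi$ is induced by the morphisms $\sigma_{\ge -n}P\to\sigma_{\ge -n-1}P$ and the second morphism is induced by the canonical ones. 3. There are no nonzero phantom morphisms: if $X,Y\in\mathbf K^{-,b}(\operatorname{proj}A)$ and $h\colon X\to Y$ is a morphism in $\mathbf K(\operatorname{Proj}A)$ such that $C\to X\xrightarrow{h}Y$ is zero for every compact object $C$ of $\mathbf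 K(\operatorname{Proj}A)$ and every morphism $C\to X$, then $h=0$. -/

import Mathlib

open CategoryTheory CategoryTheory.Limits
open scoped CategoryTheory.Pretriangulated.Opposite
universe w v u

namespace PerfectCompletion

noncomputable section

/-! ### Categories of right modules -/

section Modules

lemma closedUnderFiniteProducts {R : Type u} [Ring R] (P : ObjectProperty (ModuleCat.{u} R))
    [P.IsClosedUnderIsomorphisms] (h₀ : P (ModuleCat.of R PUnit))
    (h : ∀ M N : ModuleCat.{u} R, P M → P N → P (ModuleCat.of R (M × N))) :
    P.IsClosedUnderFiniteProducts := by
  have : P.ContainsZero := ⟨_, ModuleCat.isZero_of_subsingleton _, h₀⟩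
  have : P.IsClosedUnderBinaryProducts := ⟨by
    rintro X ⟨p⟩
    have e : X ≅ p.diag.obj ⟨.left⟩ ⊞ p.diag.obj ⟨.right⟩ :=
      IsLimit.conePointUniqueUpToIso
        ((IsLimit.postcomposeHomEquiv (diagramIsoPair p.diag) _).symm p.isLimit)
        (BinaryBiproduct.isLimit _ _)
    exact P.prop_of_iso (e ≪≫ ModuleCat.biprodIsoProd _ _).symm
      (h _ _ (p.prop_diag_obj _) (p.prop_diag_obj _))⟩
  exact .mk'

variable (A : Type u) [Ring A]

/-- The finitely presented right `A`-modules; right `A`-modules are modules over `Aᵐᵒᵖ`. -/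
def finPres : ObjectProperty (ModuleCat.{u} Aᵐᵒᵖ) :=
  fun M => Module.FinitePresentation Aᵐᵒᵖ M

/-- The finitely generated projective right `A`-modules. -/
def finProj : ObjectProperty (ModuleCat.{u} Aᵐᵒᵖ) :=
  fun M => Module.Finite Aᵐᵒᵖ M ∧ Module.Projective Aᵐᵒᵖ M

/-- All projective right `A`-modules. -/
def allProj : ObjectProperty (ModuleCat.{u} Aᵐᵒᵖ) :=
  fun M => Module.Projective Aᵐᵒᵖ M

/-- The category `mod A` of finitely presented right `A`-modules. -/
abbrev ModFP := (finPres A).FullSubcategory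

/-- The category `proj A` of finitely generated projective right `A`-modules. -/
abbrev ProjFG := (finProj A).FullSubcategory

/-- The category `Proj A` of all projective right `A`-modules. -/
abbrev ProjAll := (allProj A).FullSubcategory

lemma finProj_le_finPres : finProj A ≤ finPres A := fun M h => by
  obtain ⟨h₁, h₂⟩ := h
  exact Module.finitePresentation_of_projective _ _

lemma finProj_le_allProj : finProj A ≤ allProj A := fun _ h => h.2

instance : (finProj A).IsClosedUnderIsomorphisms where
  of_iso e h := by
    obtain ⟨h₁, h₂⟩ := h
    exact ⟨Module.Finite.equiv e.toLinearEquiv, Module.Projective.of_equiv e.toLinearEquiv⟩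

instance : (allProj A).IsClosedUnderIsomorphisms where
  of_iso e h := by
    have : Module.Projective Aᵐᵒᵖ _ := h
    exact Module.Projective.of_equiv e.toLinearEquiv

instance : (finProj A).IsClosedUnderFiniteProducts :=
  closedUnderFiniteProducts _ ⟨inferInstance, inferInstance⟩ (by
    rintro M N ⟨_, _⟩ ⟨_, _⟩
    exact ⟨inferInstanceAs (Module.Finite Aᵐᵒᵖ (M × N)),
      inferInstanceAs (Module.Projective Aᵐᵒᵖ (M × N))⟩)

instance : (allProj A).IsClosedUnderFiniteProducts :=
  closedUnderFiniteProducts _ (inferInstanceAs (Module.Projective Aᵐᵒᵖ PUnit.{u + 1})) (by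
    intro M N (_ : Module.Projective Aᵐᵒᵖ M) (_ : Module.Projective Aᵐᵒᵖ N)
    exact inferInstanceAs (Module.Projective Aᵐᵒᵖ (M × N)))

instance : HasFiniteBiproducts (ProjFG A) := .of_hasFiniteProducts
instance : HasFiniteBiproducts (ProjAll A) := .of_hasFiniteProducts
instance : HasBinaryBiproducts (ProjFG A) := hasBinaryBiproducts_of_finite_biproducts _
instance : HasBinaryBiproducts (ProjAll A) := hasBinaryBiproducts_of_finite_biproducts _
instance : HasZeroObject (ProjFG A) := hasZeroObject_of_hasFiniteBiproducts _
instance : HasZeroObject (ProjAll A) := hasZeroObject_of_hasFiniteBiproducts _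

/-- The inclusion of `proj A` into `mod A`. -/
abbrev projToMod : ProjFG A ⥤ ModFP A := ObjectProperty.ιOfLE (finProj_le_finPres A)

/-- The inclusion of `proj A` into `Proj A`. -/
abbrev projToProj : ProjFG A ⥤ ProjAll A := ObjectProperty.ιOfLE (finProj_le_allProj A)

instance : (projToMod A).Additive where
instance : (projToProj A).Additive where

/-- A preadditive category is abelian: it has finite products, kernels and cokernels, every
monomorphism is a kernel and every epimorphism is a cokernel. -/
class IsAbelianCategory (C : Type u) [Category.{v} C] [Preadditive C] : Prop where
  hasFiniteProducts : HasFiniteProducts C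
  hasKernels : HasKernels C
  hasCokernels : HasCokernels C
  isNormalMonoCategory : IsNormalMonoCategory C
  isNormalEpiCategory : IsNormalEpiCategory C

/-- A ring `A` is right coherent if the category `mod A` of finitely presented right
`A`-modules is abelian. -/
class IsRightCoherent : Prop where
  isAbelian : IsAbelianCategory (ModFP A)

instance [IsRightCoherent A] : Abelian (ModFP A) :=
  have h := IsRightCoherent.isAbelian (A := A)
  { has_kernels := h.hasKernels
    has_cokernels := h.hasCokernels
    has_finite_products := h.hasFiniteProducts
    toIsNormalMonoCategory := h.isNormalMonoCategory
    toIsNormalEpiCategory := h.isNormalEpiCategory }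

instance : EssentiallySmall.{u} (ModFP A) := by
  let F : ModFP A ⥤ FGModuleCat.{u} Aᵐᵒᵖ := ObjectProperty.ιOfLE (by
    intro M (h : Module.FinitePresentation Aᵐᵒᵖ M)
    exact inferInstanceAs (Module.Finite Aᵐᵒᵖ M))
  have : F.Full := ObjectProperty.full_ιOfLE _
  have : F.Faithful := ObjectProperty.faithful_ιOfLE _
  exact essentiallySmall_of_fully_faithful F


attribute [local instance] uliftCategory in
lemma nonempty_hasDerivedCategory [IsRightCoherent A] :
    Nonempty (HasDerivedCategory.{u} (ModFP A)) := by
  let S := SmallModel.{u} (ModFP A)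
  let e : ModFP A ≌ S := equivSmallModel.{u} (ModFP A)
  let : Preadditive S := Preadditive.ofFullyFaithful e.fullyFaithfulInverse
  have : e.symm.functor.Additive :=
    e.fullyFaithfulInverse.additive_ofFullyFaithful
  have : e.functor.Additive := e.symm.inverse_additive
  let E : CochainComplex (ModFP A) ℤ ≌ CochainComplex S ℤ := e.mapHomologicalComplex _
  let W := HomologicalComplex.quasiIso (ModFP A) (.up ℤ)
  let W' := W.inverseImage E.inverse
  let G : W'.Localization ≌ ULift.{u + 1} W'.Localization := ULift.equivalence
  have h₁ : (W'.Q ⋙ G.functor).IsLocalization W' :=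
    Functor.IsLocalization.of_equivalence_target W'.Q W' _ G (Iso.refl _)
  have h₂ : W.IsInvertedBy (E.functor ⋙ W'.Q ⋙ G.functor) := fun X Y f hf => by
    refine Localization.inverts (W'.Q ⋙ G.functor) W' (E.functor.map f) ?_
    exact (W.arrow_mk_iso_iff (Arrow.isoOfNatIso E.unitIso (Arrow.mk f))).1 hf
  exact ⟨{
    D := ULift.{u + 1} W'.Localization
    L := E.functor ⋙ W'.Q ⋙ G.functor
    hL := Functor.IsLocalization.of_equivalence_source (W'.Q ⋙ G.functor) W'
      _ W E.symm (fun X Y f hf => W.le_isoClosure _ hf) h₂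
      ((Functor.associator _ _ _).symm ≪≫ Functor.isoWhiskerRight E.counitIso _ ≪≫
        Functor.leftUnitor _) }⟩

/-- A derived category of `mod A` with morphisms in `Type u`. -/
instance [IsRightCoherent A] : HasDerivedCategory.{u} (ModFP A) :=
  Classical.choice (nonempty_hasDerivedCategory A)

end Modules

/-! ### Sequential Cauchy completion -/

section Completion

lemma isIso_colim_map_of_eventually {F G : ℕ ⥤ AddCommGrpCat.{v}} (φ : F ⟶ G) (n : ℕ)
    (h : ∀ i : ℕ, n ≤ i → Function.Bijective (φ.app i)) : IsIso (colim.map φ) := by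
  have : PreservesFilteredColimitsOfSize.{0, 0} (forget AddCommGrpCat.{v}) :=
    preservesFilteredColimitsOfSize_shrink.{0, v, 0, v} _
  have hι (i : ℕ) (x : F.obj i) :
      colim.map φ (colimit.ι F i x) = colimit.ι G i (φ.app i x) := by
    rw [← ConcreteCategory.comp_apply, ← ConcreteCategory.comp_apply]
    congr 2
    simp
  have hF (x : (colimit F : AddCommGrpCat.{v})) :
      ∃ (i : ℕ) (_ : n ≤ i) (y : F.obj i), colimit.ι F i y = x := by
    obtain ⟨i, y, rfl⟩ := Concrete.colimit_exists_rep F x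
    refine ⟨max n i, le_max_left _ _, F.map (homOfLE (le_max_right n i)) y, ?_⟩
    exact ConcreteCategory.congr_hom (colimit.w F (homOfLE (le_max_right n i))) y
  rw [ConcreteCategory.isIso_iff_bijective]
  constructor
  · rw [injective_iff_map_eq_zero]
    intro x hx
    obtain ⟨i, hi, y, rfl⟩ := hF x
    rw [hι, ← map_zero (colimit.ι G i).hom] at hx
    obtain ⟨k, f, g, hk⟩ := Concrete.colimit_exists_of_rep_eq G _ _ hx
    obtain rfl : f = g := Subsingleton.elim _ _
    have h₁ : φ.app k (F.map f y) = φ.app k 0 := by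
      rw [map_zero]
      erw [map_zero] at hk
      rw [← hk]
      exact ConcreteCategory.congr_hom (φ.naturality f) y
    have h₂ := (h k (hi.trans (leOfHom f))).1 h₁
    have h₃ := ConcreteCategory.congr_hom (colimit.w F f) y
    rw [← h₃, ConcreteCategory.comp_apply, h₂, map_zero]
  · intro x
    obtain ⟨i, y, rfl⟩ := Concrete.colimit_exists_rep G x
    obtain ⟨z, hz⟩ := (h (max n i) (le_max_left _ _)).2 (G.map (homOfLE (le_max_right n i)) y)
    refine ⟨colimit.ι F _ z, ?_⟩
    rw [hι, hz]
    exact ConcreteCategory.congr_hom (colimit.w G (homOfLE (le_max_right n i))) y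

section

variable (C : Type w) [Category.{v} C]

/-- Cauchy sequences in `C`: for every `c` the maps `Hom(c, X_i) → Hom(c, X_j)` are bijective
for `j ≥ i ≥ n_c`. -/
def isCauchy : ObjectProperty (ℕ ⥤ C) := fun X =>
  ∀ c : C, ∃ n : ℕ, ∀ (i j : ℕ) (_ : n ≤ i) (hij : i ≤ j),
    Function.Bijective (fun g : c ⟶ X.obj i => g ≫ X.map (homOfLE hij))

/-- The category of Cauchy sequences in `C`. -/
abbrev Cau := (isCauchy C).FullSubcategory

/-- The eventually invertible morphisms between Cauchy sequences. -/
def eventuallyInvertible : MorphismProperty (Cau C) := fun X _ φ =>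
  ∀ c : C, ∃ n : ℕ, ∀ i : ℕ, n ≤ i →
    Function.Bijective (fun g : c ⟶ X.obj.obj i => g ≫ φ.hom.app i)

/-- The sequential Cauchy completion of `C`. -/
abbrev IndCau := (eventuallyInvertible C).Localization

variable [Preadditive C]

/-- The functor sending a sequence `X` to `colim_i Hom(-, X_i)`. -/
def seqColim : (ℕ ⥤ C) ⥤ (Cᵒᵖ ⥤ AddCommGrpCat.{v}) :=
  (Functor.whiskeringRight ℕ C _).obj preadditiveYoneda ⋙ colim

lemma eventuallyInvertible_isInvertedBy :
    (eventuallyInvertible C).IsInvertedBy ((isCauchy C).ι ⋙ seqColim C) := by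
  intro X Y φ hφ
  have (c : Cᵒᵖ) : IsIso ((((isCauchy C).ι ⋙ seqColim C).map φ).app c) := by
    obtain ⟨n, hn⟩ := hφ c.unop
    let ψ := Functor.whiskerRight
      (((Functor.whiskeringRight ℕ C _).obj preadditiveYoneda).map φ.hom)
      ((evaluation Cᵒᵖ AddCommGrpCat.{v}).obj c)
    have h : IsIso (colim.map ψ) := isIso_colim_map_of_eventually ψ n hn
    exact ((MorphismProperty.isomorphisms _).arrow_mk_iso_iff (Arrow.isoOfNatIso
      (preservesColimitNatIso (J := ℕ) ((evaluation Cᵒᵖ AddCommGrpCat.{v}).obj c))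
      (Arrow.mk (((Functor.whiskeringRight ℕ C _).obj preadditiveYoneda).map φ.hom)))).2 h
  exact NatIso.isIso_of_isIso_app _

/-- The canonical functor from the sequential Cauchy completion of `C` to functors `Cᵒᵖ ⥤ Ab`,
induced by `X ↦ colim_i Hom(-, X_i)`. -/
def indCauToFunctor : IndCau C ⥤ (Cᵒᵖ ⥤ AddCommGrpCat.{v}) :=
  Localization.Construction.lift ((isCauchy C).ι ⋙ seqColim C)
    (eventuallyInvertible_isInvertedBy C)

end

variable (C : Type w) [Category.{v} C] [Preadditive C] [HasZeroObject C] [HasShift C ℤ]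
  [∀ n : ℤ, (shiftFunctor C n).Additive] [Pretriangulated C]

/-- The category `Coh C` of cohomological functors `Cᵒᵖ ⥤ Ab`. -/
abbrev Coh := ObjectProperty.FullSubcategory
  (fun F : Cᵒᵖ ⥤ AddCommGrpCat.{v} => F.IsHomological)

variable {C}
variable {D : Type*} [Category.{v} D] [Preadditive D] [HasZeroObject D] [HasShift D ℤ]
  [∀ n : ℤ, (shiftFunctor D n).Additive] [Pretriangulated D]

/-- The restriction `D ⥤ Coh C`, `X ↦ Hom(-, X) ∘ f`, along an exact functor `f : C ⥤ D`. -/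
def restriction (f : C ⥤ D) [f.CommShift ℤ] [f.IsTriangulated] : D ⥤ Coh C :=
  ObjectProperty.lift _
    (preadditiveYoneda ⋙ (Functor.whiskeringLeft _ _ AddCommGrpCat.{v}).obj f.op)
    (fun X => inferInstanceAs (f.op ⋙ preadditiveYoneda.obj X).IsHomological)

/-- A functor `f : C ⥤ D` of triangulated categories, compatible with the shifts, is a partial
completion if it is fully faithful and exact, and if the restriction `D ⥤ Coh C` is fully
faithful. -/
structure IsPartialCompletion (f : C ⥤ D) [f.CommShift ℤ] : Prop where
  full : f.Full
  faithful : f.Faithful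
  isTriangulated : f.IsTriangulated
  full_restriction : (restriction f).Full
  faithful_restriction : (restriction f).Faithful

/-- A partial completion is Cauchy sequential if the restriction `D ⥤ Coh C` factors through the
sequential Cauchy completion of `C`; the factorisation is expressed in the category of functors
`Cᵒᵖ ⥤ Ab`, of which `Coh C` is a full subcategory. -/
structure IsCauchySequentialPartialCompletion (f : C ⥤ D) [f.CommShift ℤ] : Prop
    extends IsPartialCompletion f where
  exists_factorization : ∃ g : D ⥤ IndCau C,
    Nonempty (g ⋙ indCauToFunctor C ≅ restriction f ⋙ ObjectProperty.ι _)

end Completion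

/-! ### Homotopy colimits, compact objects and phantom morphisms -/

section Triangulated

variable {T : Type w} [Category.{v} T] [Preadditive T] [HasZeroObject T] [HasShift T ℤ]
  [∀ n : ℤ, (shiftFunctor T n).Additive] [Pretriangulated T]

/-- A cocone `s` under a sequence `X` in `T` exhibits its tip as a homotopy colimit: there are a
coproduct `∐ X_n` and a distinguished triangle `∐ X_n ⟶ ∐ X_n ⟶ s.pt ⟶ (∐ X_n)⟦1⟧` in which the
first morphism is `id - φ`, where `φ` is induced by the `X_n ⟶ X_{n+1}`, and the second one is
induced by the cocone. -/
def IsHomotopyColimit {X : ℕ ⥤ T} (s : Cocone X) : Prop :=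
  ∃ (c : Cofan X.obj) (hc : IsColimit c) (q : s.pt ⟶ c.pt⟦(1 : ℤ)⟧),
    Pretriangulated.Triangle.mk
      (𝟙 c.pt - Cofan.IsColimit.desc hc (fun n => X.map (homOfLE n.le_succ) ≫ c.inj (n + 1)))
      (Cofan.IsColimit.desc hc (fun n => s.ι.app n)) q ∈ Pretriangulated.distinguishedTriangles

/-- An object `X` is compact if `Hom(X, -)` preserves all coproducts. -/
def IsCompactObject (X : T) : Prop :=
  ∀ J : Type v, PreservesColimitsOfShape (Discrete J) (preadditiveCoyoneda.obj (Opposite.op X))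

/-- A morphism `X ⟶ Y` is phantom if every composite `C ⟶ X ⟶ Y` with `C` compact is zero. -/
def IsPhantom {X Y : T} (f : X ⟶ Y) : Prop :=
  ∀ (C : T) (_ : IsCompactObject C) (g : C ⟶ X), g ≫ f = 0

end Triangulated

/-! ### Homotopy categories and brutal truncations -/

section Complexes

set_option linter.unusedSectionVars false

variable {E : Type w} [Category.{v} E] [Preadditive E] [HasZeroObject E]

/-- The bounded cochain complexes. -/
def IsBoundedComplex (K : CochainComplex E ℤ) : Prop :=
  (∃ a : ℤ, K.IsStrictlyGE a) ∧ ∃ b : ℤ, K.IsStrictlyLE b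

variable (E) in
/-- The bounded complexes, as objects of the homotopy category `K(E)`. -/
def boundedHtpy : ObjectProperty (HomotopyCategory E (.up ℤ)) := fun K => IsBoundedComplex K.as

variable (E) in
/-- The bounded homotopy category `K^b(E)`. -/
abbrev Kb := (boundedHtpy E).FullSubcategory

lemma boundedHtpy_quotient_obj_iff (K : CochainComplex E ℤ) :
    boundedHtpy E ((HomotopyCategory.quotient _ _).obj K) ↔ IsBoundedComplex K := Iff.rfl

open ZeroObject in
instance : (boundedHtpy E).ContainsZero where
  exists_zero :=
    ⟨(HomotopyCategory.quotient _ _).obj 0, Functor.map_isZero _ (isZero_zero _),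
      (boundedHtpy_quotient_obj_iff _).2 ⟨⟨0, inferInstance⟩, ⟨0, inferInstance⟩⟩⟩

instance : (boundedHtpy E).IsStableUnderShift ℤ where
  isStableUnderShiftBy n :=
    { le_shift K hK := by
        obtain ⟨K : CochainComplex _ _, rfl⟩ := K.quotient_obj_surjective
        rw [boundedHtpy_quotient_obj_iff] at hK
        obtain ⟨⟨a, _⟩, ⟨b, _⟩⟩ := hK
        rw [ObjectProperty.prop_shift_iff, HomotopyCategory.shift_quotient_obj,
          boundedHtpy_quotient_obj_iff]
        exact ⟨⟨a - n, K.isStrictlyGE_shift a n (a - n) (by lia)⟩,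
          ⟨b - n, K.isStrictlyLE_shift b n (b - n) (by lia)⟩⟩ }

lemma isBoundedComplex_mappingCone [HasBinaryBiproducts E] {K L : CochainComplex E ℤ}
    (f : K ⟶ L) (hK : IsBoundedComplex K) (hL : IsBoundedComplex L) :
    IsBoundedComplex (CochainComplex.mappingCone f) := by
  obtain ⟨⟨a₁, _⟩, ⟨b₁, _⟩⟩ := hK
  obtain ⟨⟨a₂, _⟩, ⟨b₂, _⟩⟩ := hL
  refine ⟨⟨min (a₁ - 1) a₂, CochainComplex.isStrictlyGE_mappingCone f a₁ a₂ _
      (by simp) (by simp)⟩, ⟨max b₁ b₂, ?_⟩⟩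
  rw [CochainComplex.isStrictlyLE_iff]
  intro i hi
  rw [CochainComplex.mappingCone.isZero_X_iff]
  exact ⟨K.isZero_of_isStrictlyLE b₁ _, L.isZero_of_isStrictlyLE b₂ _⟩

instance [HasBinaryBiproducts E] : (boundedHtpy E).IsTriangulatedClosed₃ where
  ext₃' T hT h₁ h₂ := by
    obtain ⟨f : T.obj₁.as ⟶ T.obj₂.as, hf⟩ :=
      (HomotopyCategory.quotient _ _).map_surjective T.mor₁
    refine ⟨_, (boundedHtpy_quotient_obj_iff _).2 (isBoundedComplex_mappingCone f h₁ h₂),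
      ⟨Pretriangulated.Triangle.π₃.mapIso (Pretriangulated.isoTriangleOfIso₁₂ T _ hT
        (HomotopyCategory.mappingCone_triangleh_distinguished f)
        (Iso.refl _) (Iso.refl _) ?_)⟩⟩
    exact (Category.comp_id _).trans (hf.symm.trans (Category.id_comp _).symm)

instance [HasBinaryBiproducts E] : (boundedHtpy E).IsTriangulated where
  toIsTriangulatedClosed₂ := .of_isTriangulatedClosed₃

/-- The brutal truncation `σ_{≥ n} K`. -/
abbrev brutalTrunc (K : CochainComplex E ℤ) (n : ℤ) : CochainComplex E ℤ :=
  K.stupidTrunc (ComplexShape.embeddingUpIntGE n)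

/-- The identification of `(σ_{≥ n} K)^i` with `K^i` for `n ≤ i`. -/
def brutalTruncXIso (K : CochainComplex E ℤ) (n i : ℤ) (h : n ≤ i) :
    (brutalTrunc K n).X i ≅ K.X i :=
  K.stupidTruncXIso (ComplexShape.embeddingUpIntGE n) (i := (i - n).toNat) (by simp; lia)

lemma isZero_brutalTrunc (K : CochainComplex E ℤ) (n i : ℤ) (h : i < n) :
    IsZero ((brutalTrunc K n).X i) :=
  K.isZero_stupidTrunc_X _ i (by simp; lia)

lemma stupidTrunc_d {ι ι' : Type*} {c : ComplexShape ι} {c' : ComplexShape ι'}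
    (e : c.Embedding c') [e.IsRelIff] (K : HomologicalComplex E c') {i j : ι} {i' j' : ι'}
    (hi : e.f i = i') (hj : e.f j = j') :
    (K.stupidTrunc e).d i' j' =
      (K.stupidTruncXIso e hi).hom ≫ K.d i' j' ≫ (K.stupidTruncXIso e hj).inv := by
  subst hi hj
  refine ((K.restriction e).extend_d_eq e rfl rfl).trans ?_
  have h₁ : (K.stupidTruncXIso e (rfl : e.f i = e.f i)).hom =
      ((K.restriction e).extendXIso e rfl).hom := Category.comp_id _
  have h₂ : (K.stupidTruncXIso e (rfl : e.f j = e.f j)).inv =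
      ((K.restriction e).extendXIso e rfl).inv := Category.id_comp _
  exact (congr_arg₂ (fun a b => a ≫ K.d (e.f i) (e.f j) ≫ b) h₁ h₂).symm

lemma brutalTrunc_d (K : CochainComplex E ℤ) (n i j : ℤ) (hi : n ≤ i) (hj : n ≤ j) :
    (brutalTrunc K n).d i j =
      (brutalTruncXIso K n i hi).hom ≫ K.d i j ≫ (brutalTruncXIso K n j hj).inv :=
  stupidTrunc_d _ K _ _

/-- The canonical morphism `σ_{≥ n} K ⟶ K`: the identity in degrees `≥ n`, zero elsewhere. -/
def brutalTruncι (K : CochainComplex E ℤ) (n : ℤ) : brutalTrunc K n ⟶ K where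
  f i := if h : n ≤ i then (brutalTruncXIso K n i h).hom else 0
  comm' i j hij := by
    simp only [ComplexShape.up_Rel] at hij
    by_cases hi : n ≤ i
    · simp [hi, show n ≤ j by lia, brutalTrunc_d K n i j hi (by lia)]
    · exact (isZero_brutalTrunc K n i (by lia)).eq_of_src _ _

/-- The canonical morphism `σ_{≥ n} K ⟶ σ_{≥ m} K` for `m ≤ n`: the identity in degrees `≥ n`,
zero elsewhere. -/
def brutalTruncMap (K : CochainComplex E ℤ) {n m : ℤ} (hmn : m ≤ n) :
    brutalTrunc K n ⟶ brutalTrunc K m where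
  f i := if h : n ≤ i then
    (brutalTruncXIso K n i h).hom ≫ (brutalTruncXIso K m i (hmn.trans h)).inv else 0
  comm' i j hij := by
    simp only [ComplexShape.up_Rel] at hij
    by_cases hi : n ≤ i
    · simp [hi, show n ≤ j by lia, brutalTrunc_d K n i j hi (by lia),
        brutalTrunc_d K m i j (by lia) (by lia)]
    · exact (isZero_brutalTrunc K n i (by lia)).eq_of_src _ _

/-- The sequence `σ_{≥ 0} K ⟶ σ_{≥ -1} K ⟶ σ_{≥ -2} K ⟶ ⋯` of brutal truncations. -/
def brutalTruncSeq (K : CochainComplex E ℤ) : ℕ ⥤ CochainComplex E ℤ where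
  obj n := brutalTrunc K (-n)
  map {n m} h := brutalTruncMap K (by have := leOfHom h; lia)
  map_id n := by
    ext i
    by_cases hi : -(n : ℤ) ≤ i
    · simp [brutalTruncMap, hi]
    · exact (isZero_brutalTrunc K _ i (by lia)).eq_of_src _ _
  map_comp {n m k} f g := by
    have := leOfHom f
    ext i
    by_cases hi : -(n : ℤ) ≤ i
    · simp [brutalTruncMap, hi, show -(m : ℤ) ≤ i by lia]
    · exact (isZero_brutalTrunc K _ i (by lia)).eq_of_src _ _

/-- The cocone given by the canonical morphisms `σ_{≥ -n} K ⟶ K`. -/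
def brutalTruncCocone (K : CochainComplex E ℤ) : Cocone (brutalTruncSeq K) where
  pt := K
  ι.app n := brutalTruncι K (-n)
  ι.naturality {n m} f := by
    have := leOfHom f
    ext i
    by_cases hi : -(n : ℤ) ≤ i
    · simp [brutalTruncSeq, brutalTruncι, brutalTruncMap, hi, show -(m : ℤ) ≤ i by lia]
    · exact (isZero_brutalTrunc K _ i (by lia)).eq_of_src _ _

lemma isBoundedComplex_brutalTrunc (K : CochainComplex E ℤ) (hK : ∃ b : ℤ, K.IsStrictlyLE b)
    (n : ℤ) : IsBoundedComplex (brutalTrunc K n) :=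
  ⟨⟨n, inferInstance⟩, by obtain ⟨b, _⟩ := hK; exact ⟨b, inferInstance⟩⟩

/-- For a bounded above complex `K`, the sequence of brutal truncations in `K^b(E)`. -/
def brutalTruncSeqKb (K : CochainComplex E ℤ) (hK : ∃ b : ℤ, K.IsStrictlyLE b) : ℕ ⥤ Kb E :=
  (boundedHtpy E).lift (brutalTruncSeq K ⋙ HomotopyCategory.quotient E (.up ℤ))
    (fun n => isBoundedComplex_brutalTrunc K hK (-n))

end Complexes

/-! ### The derived categories -/

section Derived

set_option linter.unusedSectionVars false

variable (A : Type u) [Ring A]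

/-- The bounded derived category `D^b(proj A)`: every exact sequence in the exact category `proj A`
splits, hence every bounded acyclic complex is contractible and the derived category is the
homotopy category `K^b(proj A)`. -/
abbrev DbProj := Kb (ProjFG A)

/-- The functor `K(proj A) ⥤ K(Proj A)` given by the inclusion. -/
abbrev toKProj : HomotopyCategory (ProjFG A) (.up ℤ) ⥤ HomotopyCategory (ProjAll A) (.up ℤ) :=
  (projToProj A).mapHomotopyCategory (.up ℤ)

variable [IsRightCoherent A]

/-- The bounded derived category `D^b(mod A)`, the full subcategory of the derived category of the
abelian category `mod A` given by the bounded objects. -/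
abbrev DbMod := (DerivedCategory.TStructure.t (C := ModFP A)).bounded.FullSubcategory

/-- The functor `K(proj A) ⥤ D(mod A)` induced by the inclusion of `proj A` into `mod A`. -/
abbrev projToDerived : HomotopyCategory (ProjFG A) (.up ℤ) ⥤ DerivedCategory (ModFP A) :=
  (projToMod A).mapHomotopyCategory (.up ℤ) ⋙ DerivedCategory.Qh

/-- The complexes `P` of finitely generated projective modules which are bounded above and have
bounded cohomology (computed in `mod A`). -/
def IsBoundedAboveWithBoundedCohomology (P : CochainComplex (ProjFG A) ℤ) : Prop :=
  (∃ b : ℤ, P.IsStrictlyLE b) ∧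
    ∃ a : ℤ, ∀ i : ℤ, i < a → (((projToMod A).mapHomologicalComplex (.up ℤ)).obj P).ExactAt i

/-- The homotopy category `K^{-,b}(proj A)`. -/
abbrev KMinusB := ObjectProperty.FullSubcategory
  (fun X : HomotopyCategory (ProjFG A) (.up ℤ) => IsBoundedAboveWithBoundedCohomology A X.as)

lemma bounded_projToDerived (P : CochainComplex (ProjFG A) ℤ)
    (hP : IsBoundedAboveWithBoundedCohomology A P) :
    (DerivedCategory.TStructure.t (C := ModFP A)).bounded
      ((projToDerived A).obj ((HomotopyCategory.quotient _ _).obj P)) := by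
  obtain ⟨⟨b, _⟩, ⟨a, ha⟩⟩ := hP
  let K : CochainComplex (ModFP A) ℤ := ((projToMod A).mapHomologicalComplex (.up ℤ)).obj P
  have e : (projToDerived A).obj ((HomotopyCategory.quotient _ _).obj P) ≅
    DerivedCategory.Q.obj K := (DerivedCategory.quotientCompQhIso (ModFP A)).app K
  have h₁ : K.IsGE a := (CochainComplex.isGE_iff _ _).2 ha
  have h₂ : K.IsStrictlyLE b := by
    rw [CochainComplex.isStrictlyLE_iff]
    intro i hi
    exact (projToMod A).map_isZero (P.isZero_of_isStrictlyLE b i)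
  have h₃ : K.IsLE b := inferInstance
  refine ObjectProperty.prop_of_iso _ e.symm ⟨⟨a, ?_⟩, ⟨b, ?_⟩⟩
  · exact (DerivedCategory.isGE_Q_obj_iff K a).2 h₁
  · exact (DerivedCategory.isLE_Q_obj_iff K b).2 h₃

lemma isBoundedAboveWithBoundedCohomology_of_isBounded (P : CochainComplex (ProjFG A) ℤ)
    (hP : IsBoundedComplex P) : IsBoundedAboveWithBoundedCohomology A P := by
  obtain ⟨⟨a, _⟩, hb⟩ := hP
  refine ⟨hb, a, fun i hi => ?_⟩
  exact ShortComplex.exact_of_isZero_X₂ _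
    ((projToMod A).map_isZero (P.isZero_of_isStrictlyGE a i))

lemma bounded_of_dbProj (X : DbProj A) :
    (DerivedCategory.TStructure.t (C := ModFP A)).bounded
      (((boundedHtpy (ProjFG A)).ι ⋙ projToDerived A).obj X) :=
  bounded_projToDerived A X.obj.as
    (isBoundedAboveWithBoundedCohomology_of_isBounded A X.obj.as X.property)

/-- The inclusion `D^b(proj A) ⥤ D^b(mod A)`. -/
def dbInclusion : DbProj A ⥤ DbMod A :=
  ObjectProperty.lift _ ((boundedHtpy (ProjFG A)).ι ⋙ projToDerived A) (bounded_of_dbProj A)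

instance : (dbInclusion A).CommShift ℤ := by
  dsimp only [dbInclusion]
  infer_instance

lemma bounded_of_kMinusB (X : KMinusB A) :
    (DerivedCategory.TStructure.t (C := ModFP A)).bounded
      ((ObjectProperty.ι _ ⋙ projToDerived A).obj X) :=
  bounded_projToDerived A X.obj.as X.property

/-- The functor `K^{-,b}(proj A) ⥤ D^b(mod A)` induced by the inclusion of `proj A` into
`mod A`. -/
def kMinusBToDbMod : KMinusB A ⥤ DbMod A :=
  ObjectProperty.lift _ (ObjectProperty.ι _ ⋙ projToDerived A) (bounded_of_kMinusB A)

/-- The sequence `σ_{≥ 0} P ⟶ σ_{≥ -1} P ⟶ ⋯` in `K(Proj A)` with the canonical morphisms to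
`P`. -/
def truncCoconeKProj (P : CochainComplex (ProjFG A) ℤ) :
    Cocone (brutalTruncSeq P ⋙ HomotopyCategory.quotient _ _ ⋙ toKProj A) :=
  (HomotopyCategory.quotient _ _ ⋙ toKProj A).mapCocone (brutalTruncCocone P)

end Derived

end

end PerfectCompletion

/-!
The functor `K^{-,b}(proj A) ⥤ D^b(mod A)` is an equivalence for the usual reasons. As `mod A` is
abelian, its epimorphisms are surjective, so that the finitely generated projective modules are the
projective objects, and there are enough of them. Bounded above complexes of projectives are
K-projective, which gives full faithfulness (`bijective_projToDerived_map`), and projective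
resolutions give essential surjectivity.

The other assertions are then about `X` and `Y` in `K^{-,b}(proj A)` and a bounded complex `C` of
finitely generated projectives, and rest on two approximation properties.

* `exists_bijective_comp_brutalTruncι`: for `n` large, `Hom(C, σ_{≥ -n} X) → Hom(C, X)` is
  bijective. A morphism and a homotopy out of `C` only see the degrees of `X` where the
  truncation agrees with `X`.
* `exists_bijective_brutalTruncι_comp`: for `n` large, `Hom(X, Y) → Hom(σ_{≥ -n} X, Y)` is
  bijective. In `D(mod A)` the cone of `σ_{≥ -n} X ⟶ X` lies in degrees `< -n`, whereas the
  cohomology of `Y` is bounded below.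

The first property shows that the truncations form a Cauchy sequence and that
`Hom(-, X) = colim Hom(-, σ_{≥ -n} X)` on bounded complexes. Together they show that a natural
transformation `Hom(-, X) ⟶ Hom(-, Y)` on bounded complexes comes from a unique morphism `X ⟶ Y`,
namely the one which is determined by the value of the transformation at `σ_{≥ -n} X ⟶ X` for `n`
large (`exists_comp_eq_of_natural`, `eq_of_comp_eq`). Hence the restricted Yoneda functor is fully
faithful. There are no phantoms since bounded complexes of finitely generated projectives are
compact in `K(Proj A)` (`isCompactObject_quotient`).

Brutal truncation is not a functor on the homotopy category. However, homotopic morphisms `X ⟶ Y`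
induce morphisms `σ_{≥ -n} X ⟶ σ_{≥ -n} Y` which become homotopic in `σ_{≥ -n-1} Y`, and the
transition morphisms of a Cauchy sequence define an eventually invertible morphism to its shift.
So the sequence of truncations is a functor to the sequential Cauchy completion
(`kMinusBToIndCau`), and this gives the factorization.

Finally, the sequence `∐ σ_{≥ -n} P ⟶ ∐ σ_{≥ -n} P ⟶ P` of complexes is degreewise split exact,
because in each degree the truncations are zero for finitely many `n` and equal to `P` afterwards
(`telescopeSplitting`). It therefore defines a distinguished triangle in the homotopy category, and
degreewise coproducts of complexes are coproducts there (`isColimitQuotientCofan`).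
-/

namespace PerfectCompletion

noncomputable section

/-! ### Coproducts in homotopy categories -/

section Coproducts

variable {E : Type*} [Category* E] [Preadditive E] {ι J : Type*} {c : ComplexShape ι}
  {Y : J → HomologicalComplex E c} (s : Cofan Y)
  (hs : ∀ i, IsColimit (Cofan.mk (f := fun j => (Y j).X i) (s.pt.X i) (fun j => (s.inj j).f i)))

/-- Homotopies between morphisms out of a degreewise coproduct can be defined on each summand. -/
def homotopyDesc {T : HomologicalComplex E c} {f g : s.pt ⟶ T}
    (H : ∀ j, Homotopy (s.inj j ≫ f) (s.inj j ≫ g)) : Homotopy f g where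
  hom i k := Cofan.IsColimit.desc (hs i) (fun j => (H j).hom i k)
  zero i k hik := Cofan.IsColimit.hom_ext (hs i) _ _ fun j => by
    rw [Cofan.IsColimit.fac, (H j).zero i k hik, comp_zero]
  comm i := Cofan.IsColimit.hom_ext (hs i) _ _ fun j => by
    have h (i k) : (s.inj j).f i ≫ Cofan.IsColimit.desc (hs i) (fun j => (H j).hom i k) =
        (H j).hom i k := Cofan.IsColimit.fac (hs i) _ j
    refine ((H j).comm i).trans ?_
    simp only [dNext, prevD, AddMonoidHom.mk'_apply, cofan_mk_inj, Preadditive.comp_add,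
      HomologicalComplex.comp_f]
    rw [HomologicalComplex.Hom.comm_assoc, h, reassoc_of% (h i (c.prev i))]

/-- A cofan of complexes which is in each degree a coproduct is a coproduct. -/
def isColimitCofanOfDegreewise : IsColimit s :=
  Cofan.IsColimit.mk _
    (fun t =>
      { f := fun i => Cofan.IsColimit.desc (hs i) (fun j => (t.inj j).f i)
        comm' := fun i k _ => Cofan.IsColimit.hom_ext (hs i) _ _ fun j => by
          have h (i) : (s.inj j).f i ≫ Cofan.IsColimit.desc (hs i) (fun j => (t.inj j).f i) =
            (t.inj j).f i := Cofan.IsColimit.fac (hs i) _ j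
          simp only [cofan_mk_inj]
          rw [reassoc_of% (h i), HomologicalComplex.Hom.comm_assoc, h,
            HomologicalComplex.Hom.comm] })
    (fun t j => by
      ext i
      exact Cofan.IsColimit.fac (hs i) _ j)
    (fun t m hm => by
      ext i
      refine Cofan.IsColimit.hom_ext (hs i) _ _ fun j => ?_
      refine Eq.trans ?_ (Cofan.IsColimit.fac (hs i) _ j).symm
      rw [← hm]
      rfl)

/-- Coproducts of complexes which are computed degreewise are also coproducts in the homotopy
category. -/
def isColimitQuotientCofan :
    IsColimit (Cofan.mk (f := fun j => (HomotopyCategory.quotient E c).obj (Y j))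
      ((HomotopyCategory.quotient E c).obj s.pt)
      (fun j => (HomotopyCategory.quotient E c).map (s.inj j))) := by
  have hf (t : Cofan (fun j => (HomotopyCategory.quotient E c).obj (Y j))) :
      ∃ (f : s.pt ⟶ t.pt.as),
        ∀ j, (HomotopyCategory.quotient E c).map (s.inj j ≫ f) = t.inj j := by
    choose u hu using fun j => (HomotopyCategory.quotient E c).map_surjective (Y := t.pt.as)
      (t.inj j)
    refine ⟨Cofan.IsColimit.desc (isColimitCofanOfDegreewise s hs) u, fun j => ?_⟩
    rw [Cofan.IsColimit.fac, hu]
  choose f hf using hf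
  refine Cofan.IsColimit.mk _ (fun t => (HomotopyCategory.quotient E c).map (f t))
    (fun t j => ((HomotopyCategory.quotient E c).map_comp _ _).symm.trans (hf t j))
    (fun t m hm => ?_)
  obtain ⟨g, rfl⟩ := (HomotopyCategory.quotient E c).map_surjective (Y := t.pt.as) m
  refine HomotopyCategory.eq_of_homotopy _ _ (homotopyDesc s hs fun j => ?_)
  refine HomotopyCategory.homotopyOfEq _ _ ((Functor.map_comp _ _ _).trans ((hm j).trans ?_))
  exact (hf t j).symm

/-- The degreewise coproduct of a family of complexes. -/
def degreewiseCofan [HasCoproductsOfShape J E] (Y : J → HomologicalComplex E c) : Cofan Y :=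
  colimit.cocone (Discrete.functor Y)

/-- `degreewiseCofan` is in each degree a coproduct. -/
def degreewiseCofanIsColimit [HasCoproductsOfShape J E] (Y : J → HomologicalComplex E c) (i : ι) :
    IsColimit (Cofan.mk (f := fun j => (Y j).X i) ((degreewiseCofan Y).pt.X i)
      (fun j => ((degreewiseCofan Y).inj j).f i)) :=
  Cofan.isColimitMapCoconeEquiv (HomologicalComplex.eval E c i) _ _
    (isColimitOfPreserves (HomologicalComplex.eval E c i)
      (colimit.isColimit (Discrete.functor Y)))

end Coproducts

/-! ### Compact objects -/

section Compact

/-- An object `X` is compact if every family has a coproduct, with projections onto the summands,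
such that each morphism from `X` to it factors through a finite subcoproduct. -/
lemma isCompactObject_of_exists_sum {T : Type w} [Category.{v} T] [Preadditive T]
    [HasZeroObject T] [HasShift T ℤ] [∀ n : ℤ, (shiftFunctor T n).Additive] [Pretriangulated T]
    (X : T) (h : ∀ (J : Type v) (Y : J → T), ∃ (c : Cofan Y) (_ : IsColimit c)
      (π : ∀ j, c.pt ⟶ Y j) (_ : ∀ j, c.inj j ≫ π j = 𝟙 _)
      (_ : ∀ i j, i ≠ j → c.inj i ≫ π j = 0),
      ∀ φ : X ⟶ c.pt, ∃ S : Finset J, φ = ∑ j ∈ S, φ ≫ π j ≫ c.inj j) :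
    IsCompactObject X := by
  intro J
  suffices ∀ (Y : J → T), PreservesColimit (Discrete.functor Y)
      (preadditiveCoyoneda.obj (Opposite.op X)) from
    ⟨fun {K} => preservesColimit_of_iso_diagram _ (Discrete.natIsoFunctor (F := K)).symm⟩
  intro Y
  obtain ⟨c, hc, π, hπ, hπ', h⟩ := h J Y
  -- the components of a morphism vanish outside of the finite set given by the hypothesis
  have hS (φ : X ⟶ c.pt) (S : Finset J) (hφ : φ = ∑ j ∈ S, φ ≫ π j ≫ c.inj j) (j : J)
      (hj : φ ≫ π j ≠ 0) : j ∈ S := by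
    by_contra hjS
    refine hj ?_
    rw [hφ, Preadditive.sum_comp]
    refine Finset.sum_eq_zero fun i hi => ?_
    rw [Category.assoc, Category.assoc, hπ' i j (by rintro rfl; exact hjS hi)]
    simp
  have hfin (φ : X ⟶ c.pt) : {j | φ ≫ π j ≠ 0}.Finite := by
    obtain ⟨S, hφ⟩ := h φ
    exact S.finite_toSet.subset fun j hj => hS φ S hφ j hj
  refine preservesColimit_of_preserves_colimit_cocone hc
    ((Cofan.isColimitMapCoconeEquiv _ _ _).symm (Cofan.IsColimit.mk _
      (fun t => AddCommGrpCat.ofHom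
        { toFun := fun φ : X ⟶ c.pt => ∑ᶠ j, t.inj j (φ ≫ π j : X ⟶ Y j)
          map_zero' := by
            refine finsum_eq_zero_of_forall_eq_zero fun j => ?_
            exact (congrArg (t.inj j) (zero_comp : (0 : X ⟶ c.pt) ≫ π j = 0)).trans
              (map_zero (t.inj j).hom)
          map_add' := fun φ ψ => ?_ }) ?_ ?_))
  · have hsupp (φ : X ⟶ c.pt) :
        (Function.support fun j => t.inj j (φ ≫ π j : X ⟶ Y j)).Finite :=
      (hfin φ).subset fun j hj hj' => hj (by
        dsimp
        rw [hj']
        exact map_zero (t.inj j).hom)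
    rw [← finsum_add_distrib (hsupp φ) (hsupp ψ)]
    refine finsum_congr fun j => ?_
    exact (congrArg (t.inj j) (Preadditive.add_comp X _ _ φ ψ (π j))).trans
      (map_add (t.inj j).hom _ _)
  · intro t k
    ext (ψ : X ⟶ Y k)
    change ∑ᶠ j, t.inj j ((ψ ≫ c.inj k) ≫ π j : X ⟶ Y j) = t.inj k ψ
    rw [finsum_eq_single _ k]
    · rw [Category.assoc, hπ, Category.comp_id]
    · intro j hj
      rw [Category.assoc, hπ' k j hj.symm, comp_zero]
      exact map_zero (t.inj j).hom
  · intro t m hm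
    ext (φ : X ⟶ c.pt)
    obtain ⟨S, hφ⟩ := h φ
    have hm' (j) (ψ : X ⟶ Y j) : m (ψ ≫ c.inj j : X ⟶ c.pt) = t.inj j ψ :=
      ConcreteCategory.congr_hom (hm j) ψ
    change m φ = ∑ᶠ j, t.inj j (φ ≫ π j : X ⟶ Y j)
    rw [finsum_eq_sum_of_support_subset (s := S)]
    · conv_lhs => rw [hφ]
      refine (map_sum m.hom _ _).trans (Finset.sum_congr rfl fun j _ => ?_)
      rw [← hm', Category.assoc]
    · intro j hj
      refine hS φ S hφ j fun hj' => hj ?_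
      dsimp
      rw [hj']
      exact map_zero (t.inj j).hom

end Compact

/-! ### Homotopy colimits of degreewise eventually constant sequences -/

section Telescope

/-- The telescope sequence `∐ X_n ⟶ ∐ X_n ⟶ P` of a sequence in a preadditive category such that
`X_n` vanishes for `n < N` and `X_n ⟶ P` is invertible for `n ≥ N` is split exact. The morphisms
`q n : P ⟶ X_n` are the inverses for `n ≥ N`, and zero for `n < N`; the section is `q N` and the
retraction is given on `X_n` by the components `- p n ≫ q k` for `k < n`. -/
def telescopeSplitting {E : Type*} [Category* E] [Preadditive E] {C P : E} {X : ℕ → E}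
    (ι : ∀ n, X n ⟶ C) (hι : IsColimit (Cofan.mk C ι)) (x : ∀ n, X n ⟶ X (n + 1))
    (p : ∀ n, X n ⟶ P) (hp : ∀ n, x n ≫ p (n + 1) = p n) (f : C ⟶ C) (g : C ⟶ P)
    (hf : ∀ n, ι n ≫ f = ι n - x n ≫ ι (n + 1)) (hg : ∀ n, ι n ≫ g = p n) (w : f ≫ g = 0)
    (N : ℕ) (q : ∀ n, P ⟶ X n) (hpq : ∀ n, p n ≫ q n = 𝟙 _)
    (hqp : ∀ n, N ≤ n → q n ≫ p n = 𝟙 _) (hq : ∀ n, n < N → q n = 0) :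
    (ShortComplex.mk f g w).Splitting :=
  have hr (n : ℕ) : ι n ≫ Cofan.IsColimit.desc hι
      (fun n => -∑ k ∈ Finset.range n, p n ≫ q k ≫ ι k) =
      -∑ k ∈ Finset.range n, p n ≫ q k ≫ ι k := Cofan.IsColimit.fac hι _ n
  { r := Cofan.IsColimit.desc hι (fun n => -∑ k ∈ Finset.range n, p n ≫ q k ≫ ι k)
    s := q N ≫ ι N
    f_r := Cofan.IsColimit.hom_ext hι _ _ fun n => by
      have h : ∑ k ∈ Finset.range n, x n ≫ p (n + 1) ≫ q k ≫ ι k =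
          ∑ k ∈ Finset.range n, p n ≫ q k ≫ ι k :=
        Finset.sum_congr rfl fun k _ => by rw [reassoc_of% (hp n)]
      dsimp
      rw [reassoc_of% (hf n), Preadditive.sub_comp, Category.assoc, hr, hr, Preadditive.comp_neg,
        Preadditive.comp_sum, Finset.sum_range_succ, reassoc_of% (hp n), reassoc_of% (hpq n),
        h, Category.comp_id]
      abel
    s_g := by simp [hg, hqp]
    id := Cofan.IsColimit.hom_ext hι _ _ fun n => by
      dsimp
      rw [Preadditive.comp_add, reassoc_of% (hr n), reassoc_of% (hg n), Category.comp_id]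
      by_cases hn : n < N
      · have h : 𝟙 (X n) = 0 := by rw [← hpq, hq n hn, comp_zero]
        rw [← cancel_epi (𝟙 (X n)), h, zero_comp, zero_comp]
      · have hs (m : ℕ) (hm : N ≤ m) :
            (∑ k ∈ Finset.range m, p n ≫ q k ≫ ι k) ≫ f =
              p n ≫ q N ≫ ι N - p n ≫ q m ≫ ι m := by
          induction m, hm using Nat.le_induction with
          | base =>
            rw [sub_self, Finset.sum_eq_zero, zero_comp]
            intro k hk
            rw [hq k (Finset.mem_range.1 hk), zero_comp, comp_zero]
          | succ m hm ih =>
            have hqx : q m ≫ x m = q (m + 1) := by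
              rw [← Category.comp_id (q m ≫ x m), ← hpq, Category.assoc, reassoc_of% (hp m),
                reassoc_of% (hqp m hm)]
            rw [Finset.sum_range_succ, Preadditive.add_comp, ih, Category.assoc, Category.assoc,
              hf, Preadditive.comp_sub, Preadditive.comp_sub, reassoc_of% hqx]
            abel
        rw [Preadditive.neg_comp, hs n (not_lt.1 hn), reassoc_of% (hpq n)]
        abel }

/-- The telescope of a sequence of complexes which in each degree is zero for finitely many indices
and constant afterwards gives a distinguished triangle in the homotopy category, since it is a
degreewise split short exact sequence. -/
lemma exists_distinguished_telescope {E : Type*} [Category* E] [Preadditive E]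
    [HasZeroObject E] [HasBinaryBiproducts E] {X : ℕ → CochainComplex E ℤ}
    {P : CochainComplex E ℤ} (x : ∀ n, X n ⟶ X (n + 1)) (p : ∀ n, X n ⟶ P)
    (hp : ∀ n, x n ≫ p (n + 1) = p n)
    (h : ∀ i : ℤ, ∃ N : ℕ, (∀ n < N, IsZero ((X n).X i)) ∧ ∀ n, N ≤ n → IsIso ((p n).f i))
    (c : Cofan X)
    (hc : ∀ i, IsColimit (Cofan.mk (f := fun j => (X j).X i) (c.pt.X i) (fun j => (c.inj j).f i)))
    (φ : c.pt ⟶ c.pt) (g : c.pt ⟶ P) (hφ : ∀ n, c.inj n ≫ φ = x n ≫ c.inj (n + 1))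
    (hg : ∀ n, c.inj n ≫ g = p n) :
    ∃ q, Pretriangulated.Triangle.mk ((HomotopyCategory.quotient E (.up ℤ)).map (𝟙 c.pt - φ))
      ((HomotopyCategory.quotient E (.up ℤ)).map g) q ∈ Pretriangulated.distinguishedTriangles := by
  have w : (𝟙 c.pt - φ) ≫ g = 0 :=
    Cofan.IsColimit.hom_ext (isColimitCofanOfDegreewise c hc) _ _ fun n => by
      rw [comp_zero, Preadditive.sub_comp, Preadditive.comp_sub, reassoc_of% (hφ n), hg,
        Category.id_comp, hg, hp, sub_self]
  have σ (i : ℤ) : Nonempty (ShortComplex.mk ((𝟙 c.pt - φ).f i) (g.f i)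
      (by rw [← HomologicalComplex.comp_f, w, HomologicalComplex.zero_f])).Splitting := by
    obtain ⟨N, hN, hN'⟩ := h i
    let q (n : ℕ) : P.X i ⟶ (X n).X i :=
      if hn : N ≤ n then have := hN' n hn; inv ((p n).f i) else 0
    refine ⟨telescopeSplitting (fun n => (c.inj n).f i) (hc i)
      (fun n => (x n).f i) (fun n => (p n).f i)
      (fun n => ?_) _ _ (fun n => ?_) (fun n => ?_) _ N q (fun n => ?_) (fun n hn => ?_)
      (fun n hn => ?_)⟩
    · rw [← HomologicalComplex.comp_f, hp]
    · rw [HomologicalComplex.sub_f_apply, Preadditive.comp_sub, HomologicalComplex.id_f,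
        Category.comp_id, ← HomologicalComplex.comp_f, hφ, HomologicalComplex.comp_f]
    · rw [← HomologicalComplex.comp_f, hg]
    · by_cases hn : N ≤ n
      · simp [q, hn]
      · exact (hN n (not_le.1 hn)).eq_of_src _ _
    · simp [q, hn]
    · simp [q, not_le.2 hn]
  exact ⟨_, (HomotopyCategory.distinguished_iff_iso_trianglehOfDegreewiseSplit _).2
    ⟨ShortComplex.mk _ _ w, fun i => (σ i).some, ⟨Iso.refl _⟩⟩⟩

/-- In the homotopy category, a cocone under a sequence of complexes which in each degree
is zero for finitely many indices and constant afterwards is a homotopy colimit. -/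
lemma isHomotopyColimit_quotient_mapCocone {E : Type w} [Category.{v} E] [Preadditive E]
    [HasZeroObject E] [HasBinaryBiproducts E] [HasCoproductsOfShape ℕ E]
    {X : ℕ ⥤ CochainComplex E ℤ} (s : Cocone X)
    (h : ∀ i : ℤ, ∃ N : ℕ, (∀ n < N, IsZero ((X.obj n).X i)) ∧
      ∀ n, N ≤ n → IsIso ((s.ι.app n).f i)) :
    IsHomotopyColimit ((HomotopyCategory.quotient E (.up ℤ)).mapCocone s) := by
  let c := degreewiseCofan X.obj
  let hc := degreewiseCofanIsColimit X.obj
  let hc' := isColimitCofanOfDegreewise c hc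
  let φ : c.pt ⟶ c.pt :=
    Cofan.IsColimit.desc hc' (fun n => X.map (homOfLE n.le_succ) ≫ c.inj (n + 1))
  let g : c.pt ⟶ s.pt := Cofan.IsColimit.desc hc' s.ι.app
  have hφ (n : ℕ) : c.inj n ≫ φ = X.map (homOfLE n.le_succ) ≫ c.inj (n + 1) :=
    Cofan.IsColimit.fac hc' _ n
  have hg (n : ℕ) : c.inj n ≫ g = s.ι.app n := Cofan.IsColimit.fac hc' _ n
  obtain ⟨q, hq⟩ := exists_distinguished_telescope (fun n => X.map (homOfLE n.le_succ))
    s.ι.app (fun n => s.w _) h c hc φ g hφ hg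
  refine ⟨_, isColimitQuotientCofan c hc, q, ?_⟩
  refine (congrArg₂ (fun a b => Pretriangulated.Triangle.mk a b q ∈
    Pretriangulated.distinguishedTriangles) ?_ ?_).mpr hq
  · rw [Functor.map_sub, CategoryTheory.Functor.map_id]
    refine congrArg (_ - ·) (Cofan.IsColimit.hom_ext (isColimitQuotientCofan c hc) _ _ fun n => ?_)
    refine (Cofan.IsColimit.fac _ _ n).trans ?_
    refine ((HomotopyCategory.quotient E (.up ℤ)).map_comp _ _).symm.trans ?_
    exact congr((HomotopyCategory.quotient E (.up ℤ)).map $((hφ n).symm)).trans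
      (Functor.map_comp _ _ _)
  · refine Cofan.IsColimit.hom_ext (isColimitQuotientCofan c hc) _ _ fun n => ?_
    refine (Cofan.IsColimit.fac _ _ n).trans ?_
    exact congr((HomotopyCategory.quotient E (.up ℤ)).map $((hg n).symm)).trans
      (Functor.map_comp _ _ _)

end Telescope

/-! ### Coproducts and compact objects in the homotopy category of projective modules -/

section ProjectiveModules

variable (A : Type u) [Ring A]

instance (J : Type*) : (allProj A).IsClosedUnderColimitsOfShape (Discrete J) where
  colimitsOfShape_le := by
    rintro M ⟨p⟩
    have h (j : Discrete J) : Projective (p.diag.obj j) :=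
      (IsProjective.iff_projective _).1 (p.prop_diag_obj j)
    refine (IsProjective.iff_projective _).2 ⟨fun {Y X} f e _ => ?_⟩
    refine ⟨p.isColimit.desc
      ⟨_, Discrete.natTrans fun j => Projective.factorThru (p.ι.app j ≫ f) e⟩,
      p.isColimit.hom_ext fun j => ?_⟩
    rw [p.isColimit.fac_assoc]
    exact Projective.factorThru_comp _ _

instance : HasCoproducts.{u} (ProjAll A) := fun _ => inferInstance

instance : HasCoproductsOfShape ℕ (ProjAll A) :=
  have : HasCoproducts.{0} (ProjAll A) := hasCoproducts_shrink.{0, u}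
  inferInstance

variable {A}

/-- A morphism from a finitely generated projective module to a coproduct of projective modules
factors through a finite subcoproduct. -/
lemma exists_finset_eq_sum {J : Type u} {Y : J → ProjAll A} (c : Cofan Y) (hc : IsColimit c)
    (π : ∀ j, c.pt ⟶ Y j) (hπ : ∀ j, c.inj j ≫ π j = 𝟙 _)
    (hπ' : ∀ i j, i ≠ j → c.inj i ≫ π j = 0) {P : ProjAll A} (hP : Module.Finite Aᵐᵒᵖ P.obj)
    (φ : P ⟶ c.pt) :
    ∃ S : Finset J, ∀ S', S ⊆ S' → φ = ∑ j ∈ S', φ ≫ π j ≫ c.inj j := by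
  classical
  let e (j : J) : c.pt.obj →ₗ[Aᵐᵒᵖ] c.pt.obj := (π j ≫ c.inj j).hom.hom
  -- the submodule of the elements which lie in a finite subsum
  let N : Submodule Aᵐᵒᵖ c.pt.obj :=
    { carrier := {x | ∃ S : Finset J, ∀ S', S ⊆ S' → x = ∑ j ∈ S', e j x}
      zero_mem' := ⟨∅, fun S' _ => by simp⟩
      add_mem' := by
        rintro x y ⟨S, hS⟩ ⟨T, hT⟩
        refine ⟨S ∪ T, fun S' hS' => ?_⟩
        simp only [map_add, Finset.sum_add_distrib]
        rw [← hS S' (Finset.union_subset_left hS'), ← hT S' (Finset.union_subset_right hS')]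
      smul_mem' := by
        rintro a x ⟨S, hS⟩
        refine ⟨S, fun S' hS' => ?_⟩
        simp only [map_smul, ← Finset.smul_sum]
        rw [← hS S' hS'] }
  have hN : N = ⊤ := by
    have h₁ : (ModuleCat.ofHom N.mkQ : c.pt.obj ⟶ ModuleCat.of Aᵐᵒᵖ (c.pt.obj ⧸ N)) = 0 := by
      refine Cofan.IsColimit.hom_ext (Cofan.isColimitMapCoconeEquiv (allProj A).ι _ _
        (isColimitOfPreserves (allProj A).ι hc)) _ _ fun j => ?_
      rw [comp_zero]
      ext y
      refine (Submodule.Quotient.mk_eq_zero N).2 ⟨{j}, fun S' hS' => ?_⟩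
      have h₂ (i : J) : e i ((c.inj j).hom.hom y) = (c.inj j ≫ π i ≫ c.inj i).hom.hom y := rfl
      refine Eq.symm ((Finset.sum_eq_single j (fun i _ hi => ?_) (fun hj => ?_)).trans ?_)
      · refine (h₂ i).trans ?_
        rw [reassoc_of% (hπ' j i hi.symm), zero_comp]
        rfl
      · exact (hj (hS' (Finset.mem_singleton_self j))).elim
      · refine (h₂ j).trans ?_
        rw [reassoc_of% (hπ j)]
        rfl
    rw [← N.ker_mkQ, LinearMap.ker_eq_top]
    exact congr(($h₁).hom)
  obtain ⟨s, hs⟩ := hP.fg_top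
  have hφ (x : P.obj) : ∃ S : Finset J, ∀ S', S ⊆ S' → φ.hom.hom x = ∑ j ∈ S', e j (φ.hom.hom x) :=
    (hN ▸ Submodule.mem_top : φ.hom.hom x ∈ N)
  choose S hS using hφ
  refine ⟨s.biUnion S, fun S' hS' => ?_⟩
  ext : 2
  refine LinearMap.ext_on hs fun x hx => ?_
  refine (hS x S' ((Finset.subset_biUnion_of_mem S hx).trans hS')).trans ?_
  let ev : (P ⟶ c.pt) →+ c.pt.obj :=
    { toFun := fun f => f.hom.hom x
      map_zero' := rfl
      map_add' := fun _ _ => rfl }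
  exact (map_sum ev (fun j => φ ≫ π j ≫ c.inj j) S').symm

lemma exists_projections {E : Type*} [Category* E] [Preadditive E] {J : Type*} {Y : J → E}
    (c : Cofan Y) (hc : IsColimit c) : ∃ (π : ∀ j, c.pt ⟶ Y j), (∀ j, c.inj j ≫ π j = 𝟙 _) ∧
      ∀ i j, i ≠ j → c.inj i ≫ π j = 0 := by
  classical
  refine ⟨fun j => Cofan.IsColimit.desc hc
    (fun i => if h : i = j then eqToHom (congrArg Y h) else 0), fun j => ?_, fun i j hij => ?_⟩
  · rw [Cofan.IsColimit.fac, dif_pos rfl, eqToHom_refl]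
  · rw [Cofan.IsColimit.fac, dif_neg hij]

/-- Bounded complexes of finitely generated projective modules are compact: a morphism to a
coproduct is given by finitely many morphisms out of finitely generated modules. -/
lemma isCompactObject_quotient (C : CochainComplex (ProjAll A) ℤ) (hC : IsBoundedComplex C)
    (hC' : ∀ i, Module.Finite Aᵐᵒᵖ (C.X i).obj) :
    IsCompactObject ((HomotopyCategory.quotient (ProjAll A) (.up ℤ)).obj C) := by
  classical
  refine isCompactObject_of_exists_sum _ fun J Y => ?_
  let s := degreewiseCofan (fun j => (Y j).as)
  let hs := degreewiseCofanIsColimit (fun j => (Y j).as)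
  obtain ⟨π, hπ, hπ'⟩ := exists_projections s (isColimitCofanOfDegreewise s hs)
  let q := HomotopyCategory.quotient (ProjAll A) (.up ℤ)
  refine ⟨_, isColimitQuotientCofan s hs, fun j => q.map (π j), fun j => ?_, fun i j hij => ?_,
    fun φ => ?_⟩
  · exact (q.map_comp _ _).symm.trans (congr(q.map $(hπ j)).trans (q.map_id _))
  · exact (q.map_comp _ _).symm.trans (congr(q.map $(hπ' i j hij)).trans (q.map_zero _ _))
  obtain ⟨φ, rfl⟩ := q.map_surjective (Y := s.pt) φ
  choose S hS using fun i => exists_finset_eq_sum _ (hs i) (fun j => (π j).f i)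
    (fun j => congr(($(hπ j)).f i)) (fun k j hkj => congr(($(hπ' k j hkj)).f i)) (hC' i) (φ.f i)
  obtain ⟨⟨a, _⟩, ⟨b, _⟩⟩ := hC
  refine ⟨(Finset.Icc a b).biUnion S, ?_⟩
  have h : φ = ∑ j ∈ (Finset.Icc a b).biUnion S, φ ≫ π j ≫ s.inj j := by
    refine HomologicalComplex.Hom.ext (funext fun i => ?_)
    by_cases hi : i ∈ Finset.Icc a b
    · refine Eq.trans ?_ (map_sum
        (HomologicalComplex.Hom.fAddMonoidHom (C₁ := C) (C₂ := s.pt) i)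
        (fun j => φ ≫ π j ≫ s.inj j) _).symm
      exact hS i _ (Finset.subset_biUnion_of_mem S hi)
    · rw [Finset.mem_Icc, not_and_or] at hi
      refine IsZero.eq_of_src ?_ _ _
      rcases hi with hi | hi
      · exact C.isZero_of_isStrictlyGE a i (by lia)
      · exact C.isZero_of_isStrictlyLE b i (by lia)
  refine congr(q.map $h).trans ((q.map_sum _ _).trans (Finset.sum_congr rfl fun j _ => ?_))
  exact (q.map_comp _ _).trans congr(_ ≫ $(q.map_comp _ _))

lemma isCompactObject_toKProj (C : Kb (ProjFG A)) : IsCompactObject ((toKProj A).obj C.obj) := by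
  obtain ⟨⟨a, _⟩, ⟨b, _⟩⟩ := C.property
  refine isCompactObject_quotient (((projToProj A).mapHomologicalComplex _).obj C.obj.as)
    ⟨⟨a, ?_⟩, ⟨b, ?_⟩⟩ (fun i => (C.obj.as.X i).property.1)
  · rw [CochainComplex.isStrictlyGE_iff]
    exact fun i hi => (projToProj A).map_isZero (CochainComplex.isZero_of_isStrictlyGE C.obj.as a i)
  · rw [CochainComplex.isStrictlyLE_iff]
    exact fun i hi => (projToProj A).map_isZero (CochainComplex.isZero_of_isStrictlyLE C.obj.as b i)

end ProjectiveModules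

/-! ### Brutal truncations in homotopy categories -/

section Truncations

variable {E : Type*} [Category* E] [Preadditive E]

/-- A morphism of complexes which is invertible in degrees `≥ a - 1` induces a bijection on
homotopy classes of morphisms from a complex concentrated in degrees `≥ a`. -/
lemma bijective_comp_quotient_map {C K L : CochainComplex E ℤ} (g : K ⟶ L) (a : ℤ)
    [C.IsStrictlyGE a] (hg : ∀ i, a - 1 ≤ i → IsIso (g.f i)) :
    Function.Bijective (fun f : (HomotopyCategory.quotient E (.up ℤ)).obj C ⟶
      (HomotopyCategory.quotient E (.up ℤ)).obj K =>
        f ≫ (HomotopyCategory.quotient E (.up ℤ)).map g) := by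
  have hr (i : ℤ) : ∃ r : L.X i ⟶ K.X i, a - 1 ≤ i → r ≫ g.f i = 𝟙 _ := by
    by_cases h : a - 1 ≤ i
    · have := hg i h
      exact ⟨inv (g.f i), fun _ => by simp⟩
    · exact ⟨0, fun h' => (h h').elim⟩
  choose r hr using hr
  constructor
  · intro f₁ f₂ h
    obtain ⟨f₁, rfl⟩ := (HomotopyCategory.quotient E (.up ℤ)).map_surjective f₁
    obtain ⟨f₂, rfl⟩ := (HomotopyCategory.quotient E (.up ℤ)).map_surjective f₂
    dsimp at h
    rw [← Functor.map_comp, ← Functor.map_comp] at h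
    let H := HomotopyCategory.homotopyOfEq _ _ h
    refine HomotopyCategory.eq_of_homotopy _ _
      { hom := fun i k => H.hom i k ≫ r k
        zero := fun i k hik => by rw [H.zero i k hik, zero_comp]
        comm := fun i => ?_ }
    by_cases hi : a ≤ i
    · have := hg i (by lia)
      have h₁ := H.comm i
      rw [dNext_eq _ (show (ComplexShape.up ℤ).Rel i (i + 1) from rfl),
        prevD_eq _ (show (ComplexShape.up ℤ).Rel (i - 1) i by simp)] at h₁ ⊢
      rw [← cancel_mono (g.f i)]
      simp only [Preadditive.add_comp, Category.assoc, HomologicalComplex.comp_f] at h₁ ⊢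
      rw [h₁, hr i (by lia), ← g.comm, reassoc_of% (hr (i - 1) (by lia)), Category.comp_id]
    · exact (C.isZero_of_isStrictlyGE a i (by lia)).eq_of_src _ _
  · intro φ
    obtain ⟨φ, rfl⟩ := (HomotopyCategory.quotient E (.up ℤ)).map_surjective φ
    refine ⟨(HomotopyCategory.quotient E (.up ℤ)).map
      { f := fun i => φ.f i ≫ r i
        comm' := fun i j hij => ?_ }, ?_⟩
    · simp only [ComplexShape.up_Rel] at hij
      by_cases hi : a ≤ i
      · have := hg j (by lia)
        rw [← cancel_mono (g.f j), Category.assoc, Category.assoc, Category.assoc, Category.assoc,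
          hr j (by lia), Category.comp_id, ← g.comm, reassoc_of% (hr i (by lia)), φ.comm]
      · exact (C.isZero_of_isStrictlyGE a i (by lia)).eq_of_src _ _
    · refine ((HomotopyCategory.quotient E (.up ℤ)).map_comp _ _).symm.trans
        (congrArg _ (HomologicalComplex.Hom.ext (funext fun i => ?_)))
      by_cases hi : a ≤ i
      · simp [hr i (by lia)]
      · exact (C.isZero_of_isStrictlyGE a i (by lia)).eq_of_src _ _

variable [HasZeroObject E] {K L M : CochainComplex E ℤ}

lemma isIso_brutalTruncι_f (K : CochainComplex E ℤ) (n i : ℤ) (hi : n ≤ i) :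
    IsIso ((brutalTruncι K n).f i) := by
  dsimp [brutalTruncι]
  rw [dif_pos hi]
  infer_instance

lemma isIso_brutalTruncMap_f (K : CochainComplex E ℤ) {n m : ℤ} (hmn : m ≤ n) (i : ℤ)
    (hi : n ≤ i) : IsIso ((brutalTruncMap K hmn).f i) := by
  dsimp [brutalTruncMap]
  rw [dif_pos hi]
  infer_instance

instance (K : CochainComplex E ℤ) (n : ℤ) : Mono (brutalTruncι K n) where
  right_cancellation f g h := by
    ext i
    by_cases hi : n ≤ i
    · have := isIso_brutalTruncι_f K n i hi
      rw [← cancel_mono ((brutalTruncι K n).f i)]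
      exact congr(($h).f i)
    · exact (isZero_brutalTrunc K n i (by lia)).eq_of_tgt _ _

lemma brutalTruncMap_ι (K : CochainComplex E ℤ) {n m : ℤ} (hmn : m ≤ n) :
    brutalTruncMap K hmn ≫ brutalTruncι K m = brutalTruncι K n := by
  ext i
  by_cases hi : n ≤ i
  · simp [brutalTruncMap, brutalTruncι, hi, hmn.trans hi]
  · exact (isZero_brutalTrunc K n i (by lia)).eq_of_src _ _

/-- The canonical morphism `σ_{≥ n} X ⟶ X` in the homotopy category. -/
abbrev brutalTruncHtpyι (X : HomotopyCategory E (.up ℤ)) (n : ℤ) :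
    (HomotopyCategory.quotient E (.up ℤ)).obj (brutalTrunc X.as n) ⟶ X :=
  (HomotopyCategory.quotient E (.up ℤ)).map (brutalTruncι X.as n)

/-- The morphism `σ_{≥ n} K ⟶ σ_{≥ n} L` induced by a morphism of complexes. -/
abbrev brutalTruncFunctorMap (φ : K ⟶ L) (n : ℤ) : brutalTrunc K n ⟶ brutalTrunc L n :=
  HomologicalComplex.stupidTruncMap φ _

lemma brutalTruncFunctorMap_ι (φ : K ⟶ L) (n : ℤ) :
    brutalTruncFunctorMap φ n ≫ brutalTruncι L n = brutalTruncι K n ≫ φ := by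
  ext i
  by_cases hi : n ≤ i
  · simp [brutalTruncι, hi, brutalTruncXIso]
  · exact (isZero_brutalTrunc K n i (by lia)).eq_of_src _ _

lemma brutalTruncFunctorMap_map (φ : K ⟶ L) {n m : ℤ} (hmn : m ≤ n) :
    brutalTruncFunctorMap φ n ≫ brutalTruncMap L hmn =
      brutalTruncMap K hmn ≫ brutalTruncFunctorMap φ m := by
  rw [← cancel_mono (brutalTruncι L m), Category.assoc, Category.assoc, brutalTruncMap_ι,
    brutalTruncFunctorMap_ι, brutalTruncFunctorMap_ι, ← Category.assoc, brutalTruncMap_ι]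

/-- The morphisms from a bounded complex to the brutal truncations of `K` stabilize. -/
lemma isCauchy_brutalTruncSeqKb {E : Type w} [Category.{v} E] [Preadditive E] [HasZeroObject E]
    (K : CochainComplex E ℤ) (hK : ∃ b : ℤ, K.IsStrictlyLE b) :
    isCauchy _ (brutalTruncSeqKb K hK) := by
  intro C
  obtain ⟨⟨a, _⟩, _⟩ := C.property
  -- from this index on, `σ_{≥ -i} K ⟶ σ_{≥ -j} K` is invertible in degrees `≥ a - 1`
  refine ⟨(1 - a).toNat, fun i j hi hij => ?_⟩
  have h := bijective_comp_quotient_map (C := C.obj.as)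
    (brutalTruncMap K (show -(j : ℤ) ≤ -i by lia)) a
    (fun k hk => isIso_brutalTruncMap_f K _ k (by lia))
  exact ⟨fun f₁ f₂ hf => ObjectProperty.hom_ext _ (h.1 congr(($hf).hom)), fun f => by
    obtain ⟨g, hg⟩ := h.2 f.hom
    exact ⟨ObjectProperty.homMk g, ObjectProperty.hom_ext _ hg⟩⟩

end Truncations

section HomotopyColimit

variable {A : Type u} [Ring A]

lemma isHomotopyColimit_truncCoconeKProj (P : CochainComplex (ProjFG A) ℤ) :
    IsHomotopyColimit (truncCoconeKProj A P) := by
  refine isHomotopyColimit_quotient_mapCocone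
    (((projToProj A).mapHomologicalComplex (.up ℤ)).mapCocone (brutalTruncCocone P))
    (fun i => ⟨(-i).toNat, fun n hn => ?_, fun n hn => ?_⟩)
  · exact (projToProj A).map_isZero (isZero_brutalTrunc P (-n) i (by lia))
  · have := isIso_brutalTruncι_f P (-n) i (by lia)
    exact inferInstanceAs (IsIso ((projToProj A).map ((brutalTruncι P (-n)).f i)))

end HomotopyColimit

/-! ### Projective resolutions of bounded above complexes -/

section Resolutions

variable {C : Type u} [Category.{v} C] [Abelian C]

lemma quasiIso_opEquivalence_map_iff {K L : CochainComplex C ℤ} (f : K ⟶ L) :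
    QuasiIso ((CochainComplex.opEquivalence C).functor.map f.op) ↔ QuasiIso f := by
  have h (i : ℤ) : QuasiIsoAt ((CochainComplex.opEquivalence C).functor.map f.op) i ↔
      QuasiIsoAt f (-i) := by
    rw [quasiIsoAt_iff' _ (i - 1) i (i + 1) (by simp) (by simp),
      quasiIsoAt_iff' f (-(i + 1)) (-i) (-(i - 1)) (by simp; lia) (by simp; lia)]
    exact ShortComplex.quasiIso_opMap_iff
      ((HomologicalComplex.shortComplexFunctor' C (.up ℤ) (-(i + 1)) (-i) (-(i - 1))).map f)
  simp only [quasiIso_iff, h]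
  exact ⟨fun H i => neg_neg i ▸ H (-i), fun H i => H (-i)⟩

/-- In an abelian category with enough projectives, every bounded above complex has a
projective resolution; this is dual to the existence of injective resolutions. -/
lemma exists_quasiIso_projective [EnoughProjectives C] (K : CochainComplex C ℤ) (b : ℤ)
    [K.IsStrictlyLE b] :
    ∃ (L : CochainComplex C ℤ) (π : L ⟶ K) (_ : ∀ i, Projective (L.X i)),
      QuasiIso π ∧ L.IsStrictlyLE b := by
  let e := CochainComplex.opEquivalence C
  have : (e.functor.obj (Opposite.op K)).IsStrictlyGE (-b) := by
    rw [CochainComplex.isStrictlyGE_iff]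
    exact fun i hi => (K.isZero_of_isStrictlyLE b (-i) (by lia)).op
  obtain ⟨I, i, hi, hI, hI'⟩ :=
    CochainComplex.Plus.modelCategoryQuillen.exists_quasiIso_injective
      (e.functor.obj (Opposite.op K)) (-b)
  let L := (e.inverse.obj I).unop
  let α : e.functor.obj (Opposite.op L) ≅ I := e.counitIso.app I
  let π : L ⟶ K := (e.functor.preimage (i ≫ α.inv)).unop
  have hα (j : ℤ) : Opposite.op (L.X (-j)) ≅ I.X j :=
    (HomologicalComplex.eval Cᵒᵖ (.up ℤ) j).mapIso α
  have hπ : e.functor.map π.op = i ≫ α.inv := e.functor.map_preimage _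
  refine ⟨L, π, fun j => ?_, ?_, ?_⟩
  · have := hI (-j)
    have h₁ : Injective (Opposite.op (L.X (- -j))) := Injective.of_iso (hα (-j)).symm this
    rw [neg_neg] at h₁
    exact Injective.projective_iff_injective_op.2 h₁
  · rw [← quasiIso_opEquivalence_map_iff]
    change QuasiIso (e.functor.map π.op)
    rw [hπ]
    infer_instance
  · rw [CochainComplex.isStrictlyLE_iff]
    intro j hj
    have h₁ := (I.isZero_of_isStrictlyGE (-b) (-j) (by lia)).of_iso (hα (-j))
    rw [neg_neg] at h₁
    exact h₁.unop

end Resolutions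

/-! ### Modules over a coherent ring -/

section Coherent

variable {A : Type u} [Ring A]

/-- The cokernel, formed in the category of modules, of a morphism between finitely presented
modules is finitely presented, so that it detects epimorphisms of `mod A`. -/
lemma surjective_of_epi {M N : ModFP A} (f : M ⟶ N) [Epi f] :
    Function.Surjective f.hom.hom := by
  have hM : Module.FinitePresentation Aᵐᵒᵖ M.obj := M.property
  have hN : Module.FinitePresentation Aᵐᵒᵖ N.obj := N.property
  have hQ : Module.FinitePresentation Aᵐᵒᵖ (N.obj ⧸ LinearMap.range f.hom.hom) :=
    Module.finitePresentation_of_surjective (Submodule.mkQ _) (Submodule.mkQ_surjective _) (by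
      rw [Submodule.ker_mkQ]
      exact Submodule.FG.of_finite)
  let Q : ModFP A := ⟨ModuleCat.of Aᵐᵒᵖ (N.obj ⧸ LinearMap.range f.hom.hom), hQ⟩
  let p : N ⟶ Q := ObjectProperty.homMk (ModuleCat.ofHom (Submodule.mkQ _))
  have h : p = 0 := by
    rw [← cancel_epi f, comp_zero]
    ext x
    exact (Submodule.Quotient.mk_eq_zero _).2 ⟨x, rfl⟩
  have h' : Submodule.mkQ (LinearMap.range f.hom.hom) = 0 := congr(($h).hom.hom)
  rw [← LinearMap.range_eq_top, ← Submodule.ker_mkQ (LinearMap.range f.hom.hom), h',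
    LinearMap.ker_zero]

lemma epi_of_surjective {M N : ModFP A} (f : M ⟶ N) (hf : Function.Surjective f.hom.hom) :
    Epi f where
  left_cancellation g h hgh := by
    ext x
    obtain ⟨y, rfl⟩ := hf x
    exact congr(($hgh).hom.hom y)

/-- A finitely generated projective module is a projective object of `mod A`, since the
epimorphisms of `mod A` are surjective. -/
instance (P : ProjFG A) : Projective ((projToMod A).obj P) where
  factors {M N} f e he := by
    have : Module.Projective Aᵐᵒᵖ ((projToMod A).obj P).obj := P.property.2
    obtain ⟨g, hg⟩ := Module.projective_lifting_property e.hom.hom f.hom.hom (surjective_of_epi e)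
    refine ⟨ObjectProperty.homMk (ModuleCat.ofHom g), ?_⟩
    ext x
    exact congr($hg x)

variable (A) in
/-- The free right module of rank `n`. -/
def freeProj (n : ℕ) : ProjFG A :=
  ⟨ModuleCat.of Aᵐᵒᵖ (Fin n → Aᵐᵒᵖ), inferInstanceAs (Module.Finite Aᵐᵒᵖ (Fin n → Aᵐᵒᵖ)),
    inferInstanceAs (Module.Projective Aᵐᵒᵖ (Fin n → Aᵐᵒᵖ))⟩

lemma exists_epi_freeProj (M : ModFP A) :
    ∃ (n : ℕ) (p : (projToMod A).obj (freeProj A n) ⟶ M), Epi p := by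
  have hM : Module.FinitePresentation Aᵐᵒᵖ M.obj := M.property
  obtain ⟨n, p, hp⟩ := Module.Finite.exists_fin' Aᵐᵒᵖ M.obj
  exact ⟨n, ObjectProperty.homMk (ModuleCat.ofHom p), epi_of_surjective _ hp⟩

instance : EnoughProjectives (ModFP A) where
  presentation M := by
    obtain ⟨n, p, hp⟩ := exists_epi_freeProj M
    exact ⟨{ p := _, f := p }⟩

lemma finProj_of_projective (M : ModFP A) [Projective M] : finProj A M.obj := by
  have hM : Module.FinitePresentation Aᵐᵒᵖ M.obj := M.property
  obtain ⟨n, p, _⟩ := exists_epi_freeProj M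
  have : Module.Projective Aᵐᵒᵖ ((projToMod A).obj (freeProj A n)).obj :=
    (freeProj A n).property.2
  refine ⟨inferInstance, Module.Projective.of_split
    (Projective.factorThru (𝟙 M) p).hom.hom p.hom.hom ?_⟩
  exact congr(($(Projective.factorThru_comp (𝟙 M) p)).hom.hom)

end Coherent

/-! ### The equivalence between `K^{-,b}(proj A)` and `D^b(mod A)` -/

section Equivalence

variable {A : Type u} [Ring A]

lemma isStrictlyLE_mapProjToMod (P : CochainComplex (ProjFG A) ℤ) (b : ℤ) [P.IsStrictlyLE b] :
    CochainComplex.IsStrictlyLE (((projToMod A).mapHomologicalComplex (.up ℤ)).obj P) b := by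
  rw [CochainComplex.isStrictlyLE_iff]
  exact fun i hi => (projToMod A).map_isZero (P.isZero_of_isStrictlyLE b i)

variable [IsRightCoherent A]

lemma isKProjective_mapProjToMod (P : CochainComplex (ProjFG A) ℤ)
    (hP : ∃ b : ℤ, P.IsStrictlyLE b) :
    CochainComplex.IsKProjective (((projToMod A).mapHomologicalComplex (.up ℤ)).obj P) := by
  obtain ⟨b, _⟩ := hP
  have := isStrictlyLE_mapProjToMod P b
  have (i : ℤ) : Projective ((((projToMod A).mapHomologicalComplex (.up ℤ)).obj P).X i) :=
    inferInstanceAs (Projective ((projToMod A).obj (P.X i)))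
  exact CochainComplex.isKProjective_of_projective _ b

/-- Bounded above complexes of finitely generated projectives are K-projective, so that morphisms
out of them in the derived category are homotopy classes of morphisms of complexes. -/
lemma bijective_projToDerived_map (X Y : HomotopyCategory (ProjFG A) (.up ℤ))
    (hX : ∃ b : ℤ, CochainComplex.IsStrictlyLE X.as b) :
    Function.Bijective ((projToDerived A).map : (X ⟶ Y) → _) := by
  have := isKProjective_mapProjToMod X.as hX
  have h₁ : Function.Bijective (((projToMod A).mapHomotopyCategory (.up ℤ)).map : (X ⟶ Y) → _) :=
    ⟨Functor.map_injective _, Functor.map_surjective _⟩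
  exact (CochainComplex.IsKProjective.Qh_map_bijective
    (((projToMod A).mapHomologicalComplex (.up ℤ)).obj X.as) _).comp h₁

instance : (kMinusBToDbMod A).Faithful where
  map_injective {X _ _ _} h := ObjectProperty.hom_ext _
    ((bijective_projToDerived_map _ _ X.property.1).1 congr(($h).hom))

instance : (kMinusBToDbMod A).Full where
  map_surjective {X Y} f := by
    obtain ⟨g, hg⟩ := (bijective_projToDerived_map _ Y.obj X.property.1).2 f.hom
    exact ⟨ObjectProperty.homMk g, ObjectProperty.hom_ext _ hg⟩

instance : (kMinusBToDbMod A).EssSurj where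
  mem_essImage X := by
    obtain ⟨⟨a, ha⟩, ⟨b, hb⟩⟩ := X.property
    obtain ⟨K, e, _⟩ := hb
    obtain ⟨L, π, hL, _, _⟩ := exists_quasiIso_projective K b
    -- the complex `L`, as a complex of finitely generated projective modules
    let P : CochainComplex (ProjFG A) ℤ :=
      { X := fun i => ⟨(L.X i).obj, finProj_of_projective _⟩
        d := fun i j => ObjectProperty.homMk (L.d i j).hom
        shape := fun i j hij => ObjectProperty.hom_ext _ congr(($(L.shape i j hij)).hom)
        d_comp_d' := fun i j k _ _ => ObjectProperty.hom_ext _ congr(($(L.d_comp_d i j k)).hom) }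
    have e' : ((projToMod A).mapHomologicalComplex (.up ℤ)).obj P ≅ L := Iso.refl _
    have hP : P.IsStrictlyLE b := by
      rw [CochainComplex.isStrictlyLE_iff]
      intro i hi
      exact IsZero.of_full_of_faithful_of_isZero (projToMod A) (P.X i)
        (L.isZero_of_isStrictlyLE b i)
    have e'' : X.obj ≅ DerivedCategory.Q.obj L :=
      e ≪≫ (asIso (DerivedCategory.Q.map π)).symm
    have ha' : L.IsGE a := (DerivedCategory.isGE_Q_obj_iff L a).1
      (have := ha
       DerivedCategory.TStructure.t.isGE_of_iso e'' a)
    let Y : KMinusB A := ⟨(HomotopyCategory.quotient _ _).obj P, ⟨b, hP⟩, a, fun i hi =>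
      L.exactAt_of_isGE a i hi⟩
    exact ⟨Y, ⟨ObjectProperty.isoMk _
      ((DerivedCategory.quotientCompQhIso (ModFP A)).app L ≪≫ e''.symm)⟩⟩

instance : (kMinusBToDbMod A).IsEquivalence where

end Equivalence

/-! ### Morphisms from a complex to objects that are bounded below -/

section Approximation

open DerivedCategory Pretriangulated

/-- A monomorphism of complexes whose cokernel lies in degrees `≤ m` induces a bijection on
morphisms to objects of the derived category with cohomology in degrees `> m + 1`. -/
lemma bijective_Q_map_comp {C : Type u} [Category.{v} C] [Abelian C] [HasDerivedCategory.{w} C]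
    {K L : CochainComplex C ℤ} (f : K ⟶ L) [Mono f] (m : ℤ)
    (hf : ∀ i, m < i → Epi (f.f i)) (Y : DerivedCategory C)
    (a : ℤ) (ha : m + 1 < a) [Y.IsGE a] :
    Function.Bijective (fun g : Q.obj L ⟶ Y => Q.map f ≫ g) := by
  let S := ShortComplex.mk f (cokernel.π f) (cokernel.condition f)
  have hS : S.ShortExact :=
    { exact := ShortComplex.exact_of_g_is_cokernel _ (cokernelIsCokernel f) }
  have hT := triangleOfSES_distinguished hS
  have hm : S.X₃.IsStrictlyLE m := by
    rw [CochainComplex.isStrictlyLE_iff]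
    intro i hi
    have := hf i hi
    have h : Epi ((cokernel.π f).f i) := inferInstance
    rw [IsZero.iff_id_eq_zero, ← cancel_epi ((cokernel.π f).f i), ← cancel_epi (f.f i),
      comp_zero, comp_zero, Category.comp_id, ← HomologicalComplex.comp_f, cokernel.condition,
      HomologicalComplex.zero_f]
  have h₁ : (triangleOfSES hS).obj₃.IsLE m := inferInstanceAs ((Q.obj S.X₃).IsLE m)
  have h₂ : (triangleOfSES hS).invRotate.obj₁.IsLE (m + 1) :=
    TStructure.t.isLE_shift (triangleOfSES hS).obj₃ m (-1) (m + 1)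
  constructor
  · intro g₁ g₂ h
    rw [← sub_eq_zero]
    obtain ⟨k, hk⟩ := Triangle.yoneda_exact₂ _ hT (g₁ - g₂)
      ((Preadditive.comp_sub _ _ _).trans (sub_eq_zero.2 h))
    rw [hk, TStructure.t.zero k m a]
    exact comp_zero
  · intro g
    obtain ⟨k, hk⟩ := Triangle.yoneda_exact₂ _ (inv_rot_of_distTriang _ hT) g
      (TStructure.t.zero _ (m + 1) a)
    exact ⟨k, hk.symm⟩

lemma bijective_Qh_map_comp {C : Type u} [Category.{v} C] [Abelian C] [HasDerivedCategory.{w} C]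
    {K L : CochainComplex C ℤ} (f : K ⟶ L) [Mono f] (m : ℤ)
    (hf : ∀ i, m < i → Epi (f.f i)) (Y : DerivedCategory C)
    (a : ℤ) (ha : m + 1 < a) [Y.IsGE a] :
    Function.Bijective (fun g : Qh.obj ((HomotopyCategory.quotient C (.up ℤ)).obj L) ⟶ Y =>
      Qh.map ((HomotopyCategory.quotient C (.up ℤ)).map f) ≫ g) := by
  let e := quotientCompQhIso C
  have h : (fun g : Qh.obj ((HomotopyCategory.quotient C (.up ℤ)).obj L) ⟶ Y =>
      Qh.map ((HomotopyCategory.quotient C (.up ℤ)).map f) ≫ g) =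
      (fun g => e.hom.app K ≫ g) ∘ (fun g => Q.map f ≫ g) ∘ (fun g => e.inv.app L ≫ g) := by
    ext g
    dsimp
    rw [← NatTrans.naturality_assoc, e.hom_inv_id_app_assoc]
    rfl
  rw [h]
  exact ((e.app K).homFromEquiv.symm.bijective).comp
    ((bijective_Q_map_comp f m hf Y a ha).comp (e.app L).homFromEquiv.bijective)

variable {A : Type u} [Ring A] [IsRightCoherent A]

/-- For `X` and `Y` in `K^{-,b}(proj A)`, the morphisms `X ⟶ Y` are determined by their restrictions
to the brutal truncation `σ_{≥ -n} X`, for `n` large enough: the third term of the triangle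
on `σ_{≥ -n} X ⟶ X` lies in degrees `< -n`, so it has no morphisms to `Y`. -/
lemma exists_bijective_brutalTruncι_comp (X Y : KMinusB A) :
    ∃ N : ℕ, ∀ n : ℕ, N ≤ n →
      Function.Bijective (fun g : X.obj ⟶ Y.obj => brutalTruncHtpyι X.obj (-n) ≫ g) := by
  obtain ⟨⟨a, ha⟩, -⟩ := bounded_of_kMinusB A Y
  have : IsGE ((projToDerived A).obj Y.obj) a := ha
  -- the cokernel of `σ_{≥ -n} X ⟶ X` lies in degrees `≤ -n - 1`, and `-n < a` is needed
  refine ⟨(1 - a).toNat, fun n hn => ?_⟩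
  let P : CochainComplex (ProjFG A) ℤ := X.obj.as
  let f := ((projToMod A).mapHomologicalComplex (.up ℤ)).map (brutalTruncι P (-n))
  have hf (i : ℤ) (hi : -(n : ℤ) ≤ i) : IsIso (f.f i) := by
    have := isIso_brutalTruncι_f P (-n) i hi
    exact inferInstanceAs (IsIso ((projToMod A).map ((brutalTruncι P (-n)).f i)))
  have hf' : Mono f := HomologicalComplex.mono_of_mono_f _ fun i => by
    by_cases hi : -(n : ℤ) ≤ i
    · have := hf i hi
      infer_instance
    · exact ((projToMod A).map_isZero (isZero_brutalTrunc P (-n) i (by lia))).mono _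
  have h₁ := bijective_Qh_map_comp f (-n - 1) (fun i hi => have := hf i (by lia); inferInstance)
    ((projToDerived A).obj Y.obj) a (by lia)
  have h₂ := bijective_projToDerived_map X.obj Y.obj X.property.1
  have h₃ := bijective_projToDerived_map
    ((HomotopyCategory.quotient (ProjFG A) (.up ℤ)).obj (brutalTrunc P (-n))) Y.obj
    (isBoundedComplex_brutalTrunc P X.property.1 _).2
  rw [← Function.Bijective.of_comp_iff' h₃]
  have h : (projToDerived A).map ∘ (fun g : X.obj ⟶ Y.obj => brutalTruncHtpyι X.obj (-n) ≫ g) =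
      (fun g => (projToDerived A).map (brutalTruncHtpyι X.obj (-n)) ≫ g) ∘
        (projToDerived A).map := by
    ext g
    exact (projToDerived A).map_comp _ _
  rw [h]
  exact Function.Bijective.comp h₁ h₂

end Approximation

/-! ### Full faithfulness of the restricted Yoneda functor and phantom morphisms -/

section RestrictedYoneda

variable {A : Type u} [Ring A]

/-- The brutal truncation `σ_{≥ -n} X`, in `K^b(proj A)`, of an object of `K^{-,b}(proj A)`. -/
abbrev truncKb (X : KMinusB A) (n : ℕ) : Kb (ProjFG A) :=
  (brutalTruncSeqKb X.obj.as X.property.1).obj n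

/-- Every morphism from a bounded complex to `X` factors uniquely through the brutal truncation
`σ_{≥ -n} X`, for `n` large enough. -/
lemma exists_bijective_comp_brutalTruncι (C : Kb (ProjFG A)) (X : KMinusB A) :
    ∃ N : ℕ, ∀ n : ℕ, N ≤ n →
      Function.Bijective
        (fun f : C.obj ⟶ (truncKb X n).obj => f ≫ brutalTruncHtpyι X.obj (-n)) := by
  obtain ⟨⟨a, _⟩, _⟩ := C.property
  -- from this index on, `σ_{≥ -n} X ⟶ X` is invertible in degrees `≥ a - 1`
  exact ⟨(1 - a).toNat, fun n hn => bijective_comp_quotient_map (C := C.obj.as) (a := a) _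
    (fun k hk => isIso_brutalTruncι_f X.obj.as _ k (by lia))⟩

variable [IsRightCoherent A]

variable (A) in
/-- The inclusion of `K^b(proj A)` into `K^{-,b}(proj A)`. -/
abbrev kbToKMinusB : Kb (ProjFG A) ⥤ KMinusB A :=
  ObjectProperty.ιOfLE (fun K hK => isBoundedAboveWithBoundedCohomology_of_isBounded A K.as hK)

/-- A natural transformation `Hom(-, X) ⟶ Hom(-, Y)` of functors on `K^b(proj A)` is induced by a
morphism `X ⟶ Y`: this morphism is determined by the value of the transformation at a truncation of
`X`, and the compatibility with other morphisms to `X` is checked on truncations of `X`. -/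
lemma exists_comp_eq_of_natural (X Y : KMinusB A)
    (η : ∀ C : Kb (ProjFG A), (C.obj ⟶ X.obj) → (C.obj ⟶ Y.obj))
    (hη : ∀ (C C' : Kb (ProjFG A)) (u : C ⟶ C') (φ : C'.obj ⟶ X.obj),
      η C (u.hom ≫ φ) = u.hom ≫ η C' φ) :
    ∃ g : X.obj ⟶ Y.obj, ∀ (C : Kb (ProjFG A)) (φ : C.obj ⟶ X.obj), φ ≫ g = η C φ := by
  let c (n : ℕ) : (truncKb X n).obj ⟶ X.obj := brutalTruncHtpyι X.obj (-n)
  obtain ⟨N, hN⟩ := exists_bijective_brutalTruncι_comp X Y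
  obtain ⟨g, hg : c N ≫ g = η _ (c N)⟩ := (hN N le_rfl).2 (η (truncKb X N) (c N))
  have key (m : ℕ) (hm : N ≤ m) : c m ≫ g = η _ (c m) := by
    obtain ⟨g', hg' : c m ≫ g' = η _ (c m)⟩ := (hN m hm).2 (η (truncKb X m) (c m))
    let j : truncKb X N ⟶ truncKb X m :=
      (brutalTruncSeqKb X.obj.as X.property.1).map (homOfLE hm)
    have hj : j.hom ≫ c m = c N :=
      ((HomotopyCategory.quotient (ProjFG A) (.up ℤ)).map_comp _ _).symm.trans
        congr((HomotopyCategory.quotient (ProjFG A) (.up ℤ)).map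
          $(brutalTruncMap_ι X.obj.as (show -(m : ℤ) ≤ -N by lia)))
    have h : g = g' := (hN N le_rfl).1 (by
      change c N ≫ g = c N ≫ g'
      rw [hg, ← hj, hη, Category.assoc, hg'])
    rw [h, hg']
  refine ⟨g, fun C φ => ?_⟩
  obtain ⟨M, hM⟩ := exists_bijective_comp_brutalTruncι C X
  obtain ⟨t, rfl⟩ := (hM (max N M) (le_max_right _ _)).2 φ
  change (t ≫ c _) ≫ g = η C (t ≫ c _)
  rw [Category.assoc, key _ (le_max_left _ _)]
  exact (hη C _ (ObjectProperty.homMk t) _).symm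

/-- Morphisms in `K^{-,b}(proj A)` are determined by their composites with the morphisms from
bounded complexes. -/
lemma eq_of_comp_eq {X Y : KMinusB A} {g₁ g₂ : X.obj ⟶ Y.obj}
    (h : ∀ (C : Kb (ProjFG A)) (φ : C.obj ⟶ X.obj), φ ≫ g₁ = φ ≫ g₂) : g₁ = g₂ := by
  obtain ⟨N, hN⟩ := exists_bijective_brutalTruncι_comp X Y
  exact (hN N le_rfl).1 (h (truncKb X N) _)

/-- Phantom morphisms vanish since bounded complexes of finitely generated projective modules are
compact, and detect morphisms. -/
lemma eq_zero_of_isPhantom (X Y : KMinusB A)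
    (f : (toKProj A).obj X.obj ⟶ (toKProj A).obj Y.obj) (hf : IsPhantom f) : f = 0 := by
  obtain ⟨g, rfl⟩ := (toKProj A).map_surjective f
  have h : g = 0 := eq_of_comp_eq fun C φ => (toKProj A).map_injective (by
    rw [comp_zero, Functor.map_comp, Functor.map_zero]
    exact hf _ (isCompactObject_toKProj C) _)
  rw [h, Functor.map_zero]

instance : (dbInclusion A).Full :=
  inferInstanceAs (kbToKMinusB A ⋙ kMinusBToDbMod A).Full

instance : (dbInclusion A).Faithful :=
  inferInstanceAs (kbToKMinusB A ⋙ kMinusBToDbMod A).Faithful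

instance : (dbInclusion A).IsTriangulated :=
  ObjectProperty.isTriangulated_lift _ ((boundedHtpy (ProjFG A)).ι ⋙ projToDerived A)
    (bounded_of_dbProj A)

instance : (kMinusBToDbMod A ⋙ restriction (dbInclusion A)).Faithful where
  map_injective {X Y g₁ g₂} h := by
    refine ObjectProperty.hom_ext _ (eq_of_comp_eq fun C φ => ?_)
    let φ' : (kbToKMinusB A).obj C ⟶ X := ObjectProperty.homMk φ
    have h' : (kMinusBToDbMod A).map φ' ≫ (kMinusBToDbMod A).map g₁ =
        (kMinusBToDbMod A).map φ' ≫ (kMinusBToDbMod A).map g₂ :=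
      congr(($h).hom.app (Opposite.op C) ((kMinusBToDbMod A).map φ'))
    rw [← Functor.map_comp, ← Functor.map_comp] at h'
    exact congr(($((kMinusBToDbMod A).map_injective h')).hom)

instance : (kMinusBToDbMod A ⋙ restriction (dbInclusion A)).Full where
  map_surjective {X Y} η := by
    let F := kMinusBToDbMod A
    let ε (C : Kb (ProjFG A)) (φ : (dbInclusion A).obj C ⟶ F.obj X) :
      (dbInclusion A).obj C ⟶ F.obj Y := η.hom.app (Opposite.op C) φ
    have hε (C C' : Kb (ProjFG A)) (u : C ⟶ C') (φ) :
        ε C ((dbInclusion A).map u ≫ φ) = (dbInclusion A).map u ≫ ε C' φ :=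
      ConcreteCategory.congr_hom (η.hom.naturality u.op) φ
    let e (C : Kb (ProjFG A)) (φ : C.obj ⟶ X.obj) : (kbToKMinusB A).obj C ⟶ Y :=
      F.preimage (ε C (F.map (ObjectProperty.homMk φ : (kbToKMinusB A).obj C ⟶ X)))
    have he (C : Kb (ProjFG A)) (φ : C.obj ⟶ X.obj) : F.map (e C φ) =
        ε C (F.map (ObjectProperty.homMk φ : (kbToKMinusB A).obj C ⟶ X)) := F.map_preimage _
    obtain ⟨g, hg⟩ := exists_comp_eq_of_natural X Y (fun C φ => (e C φ).hom)
      (fun C C' u φ => by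
        have h : e C (u.hom ≫ φ) = (kbToKMinusB A).map u ≫ e C' φ := F.map_injective (by
          rw [he, F.map_comp, he]
          refine Eq.trans ?_ (hε C C' u _)
          exact congrArg (ε C) (F.map_comp ((kbToKMinusB A).map u) (ObjectProperty.homMk φ)))
        exact congr(($h).hom))
    refine ⟨ObjectProperty.homMk g, ?_⟩
    ext C φ
    obtain ⟨φ, rfl⟩ := F.map_surjective (X := (kbToKMinusB A).obj C.unop) φ
    refine Eq.trans ?_ (he C.unop φ.hom)
    refine (F.map_comp φ (ObjectProperty.homMk g)).symm.trans (congrArg F.map ?_)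
    exact ObjectProperty.hom_ext _ (hg C.unop φ.hom)

variable (A) in
/-- The restriction functor on `D^b(mod A)` expressed on `K^{-,b}(proj A)`. -/
def inverseCompRestrictionIso :
    (kMinusBToDbMod A).asEquivalence.inverse ⋙ kMinusBToDbMod A ⋙ restriction (dbInclusion A) ≅
      restriction (dbInclusion A) :=
  (Functor.associator _ _ _).symm ≪≫
    Functor.isoWhiskerRight (kMinusBToDbMod A).asEquivalence.counitIso
      (restriction (dbInclusion A)) ≪≫ Functor.leftUnitor _

instance : (restriction (dbInclusion A)).Full :=
  Functor.Full.of_iso (inverseCompRestrictionIso A)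

instance : (restriction (dbInclusion A)).Faithful :=
  Functor.Faithful.of_iso (inverseCompRestrictionIso A)

lemma isPartialCompletion_dbInclusion : IsPartialCompletion (dbInclusion A) where
  full := inferInstance
  faithful := inferInstance
  isTriangulated := inferInstance
  full_restriction := inferInstance
  faithful_restriction := inferInstance

end RestrictedYoneda

/-! ### The factorization through the sequential Cauchy completion -/

section Shift

variable {C : Type w} [Category.{v} C]

/-- The Cauchy sequence `X_1 ⟶ X_2 ⟶ ⋯` obtained from `X` by dropping the first term. -/
def seqShift (X : Cau C) : Cau C where
  obj :=
    { obj := fun n => X.obj.obj (n + 1)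
      map := fun f => X.obj.map (homOfLE (Nat.succ_le_succ (leOfHom f)))
      map_id := fun _ => X.obj.map_id _
      map_comp := fun _ _ => (congrArg _ (Subsingleton.elim _ _)).trans (X.obj.map_comp _ _) }
  property c := by
    obtain ⟨n, hn⟩ := X.property c
    exact ⟨n, fun i j hi hij => hn (i + 1) (j + 1) (by lia) (by lia)⟩

/-- The morphism from a Cauchy sequence to its shift given by the transition morphisms. -/
def toSeqShift (X : Cau C) : X ⟶ seqShift X :=
  ObjectProperty.homMk
    { app := fun n => X.obj.map (homOfLE n.le_succ)
      naturality := fun _ _ _ => (X.obj.map_comp _ _).symm.trans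
        ((congrArg _ (Subsingleton.elim _ _)).trans (X.obj.map_comp _ _)) }

lemma eventuallyInvertible_toSeqShift (X : Cau C) :
    eventuallyInvertible C (toSeqShift X) := fun c => by
  obtain ⟨n, hn⟩ := X.property c
  exact ⟨n, fun i hi => hn i (i + 1) hi i.le_succ⟩

/-- Morphisms of Cauchy sequences which agree after composition with the transition morphisms of
the target become equal in the sequential Cauchy completion. -/
lemma Q_map_eq_of_comp_map_eq {X Y : Cau C} (α β : X ⟶ Y)
    (h : ∀ n : ℕ, α.hom.app n ≫ Y.obj.map (homOfLE n.le_succ) =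
      β.hom.app n ≫ Y.obj.map (homOfLE n.le_succ)) :
    (eventuallyInvertible C).Q.map α = (eventuallyInvertible C).Q.map β := by
  have := Localization.inverts (eventuallyInvertible C).Q _ _ (eventuallyInvertible_toSeqShift Y)
  rw [← cancel_mono ((eventuallyInvertible C).Q.map (toSeqShift Y)), ← Functor.map_comp,
    ← Functor.map_comp]
  congr 1
  exact ObjectProperty.hom_ext _ (NatTrans.ext (funext h))

variable (C) in
/-- The functor `indCauToFunctor C` restricts to `X ↦ colim_i Hom(-, X_i)` on Cauchy sequences. -/
def qCompIndCauToFunctorIso [Preadditive C] :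
    (eventuallyInvertible C).Q ⋙ indCauToFunctor C ≅ (isCauchy C).ι ⋙ seqColim C :=
  eqToIso (Localization.Construction.fac _ _)

end Shift

section Factorization

variable {A : Type u} [Ring A]

/-- The Cauchy sequence of brutal truncations of an object of `K^{-,b}(proj A)`. -/
def truncCau (X : KMinusB A) : Cau (Kb (ProjFG A)) :=
  ⟨brutalTruncSeqKb X.obj.as X.property.1, isCauchy_brutalTruncSeqKb _ _⟩

/-- The morphism of Cauchy sequences induced by a morphism of complexes. -/
def truncCauMap {X Y : KMinusB A} (φ : X.obj.as ⟶ Y.obj.as) : truncCau X ⟶ truncCau Y :=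
  ObjectProperty.homMk
    { app := fun n => ObjectProperty.homMk
        ((HomotopyCategory.quotient _ _).map (brutalTruncFunctorMap φ (-n)))
      naturality := fun n m f => by
        have := leOfHom f
        refine ObjectProperty.hom_ext _ ?_
        exact ((HomotopyCategory.quotient (ProjFG A) (.up ℤ)).map_comp _ _).symm.trans
          ((congrArg _ (brutalTruncFunctorMap_map φ (show -(m : ℤ) ≤ -n by lia)).symm).trans
            ((HomotopyCategory.quotient (ProjFG A) (.up ℤ)).map_comp _ _)) }

lemma truncCauMap_id (X : KMinusB A) : truncCauMap (𝟙 X.obj.as) = 𝟙 (truncCau X) := by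
  refine ObjectProperty.hom_ext _ (NatTrans.ext (funext fun n => ObjectProperty.hom_ext _ ?_))
  exact (congrArg _ (HomologicalComplex.stupidTruncMap_id _ _)).trans
    ((HomotopyCategory.quotient (ProjFG A) (.up ℤ)).map_id _)

lemma truncCauMap_comp {X Y Z : KMinusB A} (φ : X.obj.as ⟶ Y.obj.as) (ψ : Y.obj.as ⟶ Z.obj.as) :
    truncCauMap (X := X) (Y := Z) (φ ≫ ψ) = truncCauMap φ ≫ truncCauMap ψ := by
  refine ObjectProperty.hom_ext _ (NatTrans.ext (funext fun n => ObjectProperty.hom_ext _ ?_))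
  exact (congrArg _ (HomologicalComplex.stupidTruncMap_comp _ _ _)).trans
    ((HomotopyCategory.quotient (ProjFG A) (.up ℤ)).map_comp _ _)

/-- Brutal truncation does not preserve homotopies, but homotopic morphisms `X ⟶ Y` induce homotopic
morphisms `σ_{≥ -n} X ⟶ σ_{≥ -n-1} Y`. -/
lemma Q_map_truncCauMap_eq {X Y : KMinusB A} (φ ψ : X.obj.as ⟶ Y.obj.as)
    (h : (HomotopyCategory.quotient _ _).map φ = (HomotopyCategory.quotient _ _).map ψ) :
    (eventuallyInvertible (Kb (ProjFG A))).Q.map (truncCauMap (X := X) (Y := Y) φ) =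
      (eventuallyInvertible (Kb (ProjFG A))).Q.map (truncCauMap ψ) := by
  refine Q_map_eq_of_comp_map_eq _ _ fun n => ObjectProperty.hom_ext _ ?_
  have key (χ : X.obj.as ⟶ Y.obj.as) :
      (HomotopyCategory.quotient (ProjFG A) (.up ℤ)).map (brutalTruncFunctorMap χ (-n) ≫
        brutalTruncMap Y.obj.as (show -((n + 1 : ℕ) : ℤ) ≤ -n by lia)) ≫
        (HomotopyCategory.quotient _ _).map (brutalTruncι Y.obj.as (-((n + 1 : ℕ) : ℤ))) =
      (HomotopyCategory.quotient _ _).map (brutalTruncι X.obj.as (-n)) ≫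
        (HomotopyCategory.quotient _ _).map χ := by
    rw [← Functor.map_comp, ← Functor.map_comp, Category.assoc, brutalTruncMap_ι,
      brutalTruncFunctorMap_ι]
  have := (bijective_comp_quotient_map (C := brutalTrunc X.obj.as (-n))
    (brutalTruncι Y.obj.as (-((n + 1 : ℕ) : ℤ))) (-n)
    (fun i hi => isIso_brutalTruncι_f _ _ _ (by lia))).1
    ((key φ).trans ((congrArg _ h).trans (key ψ).symm))
  exact ((HomotopyCategory.quotient (ProjFG A) (.up ℤ)).map_comp _ _).symm.trans
    (this.trans ((HomotopyCategory.quotient (ProjFG A) (.up ℤ)).map_comp _ _))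

/-- A morphism of complexes representing a morphism in the homotopy category. -/
def htpyRep {X Y : KMinusB A} (f : X ⟶ Y) : X.obj.as ⟶ Y.obj.as :=
  ((HomotopyCategory.quotient (ProjFG A) (.up ℤ)).map_surjective
    (X := X.obj.as) (Y := Y.obj.as) f.hom).choose

lemma quotient_map_htpyRep {X Y : KMinusB A} (f : X ⟶ Y) :
    (HomotopyCategory.quotient (ProjFG A) (.up ℤ)).map (htpyRep f) = f.hom :=
  ((HomotopyCategory.quotient (ProjFG A) (.up ℤ)).map_surjective
    (X := X.obj.as) (Y := Y.obj.as) f.hom).choose_spec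

variable (A) in
/-- The functor from `K^{-,b}(proj A)` to the sequential Cauchy completion of `K^b(proj A)` which
sends a complex to the sequence of its brutal truncations. -/
def kMinusBToIndCau : KMinusB A ⥤ IndCau (Kb (ProjFG A)) where
  obj X := (eventuallyInvertible _).Q.obj (truncCau X)
  map f := (eventuallyInvertible _).Q.map (truncCauMap (htpyRep f))
  map_id X := (Q_map_truncCauMap_eq (htpyRep (𝟙 X)) (𝟙 X.obj.as)
      ((quotient_map_htpyRep _).trans
        ((HomotopyCategory.quotient (ProjFG A) (.up ℤ)).map_id _).symm)).trans
    ((congrArg _ (truncCauMap_id X)).trans ((eventuallyInvertible _).Q.map_id _))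
  map_comp {X Y Z} f g := (Q_map_truncCauMap_eq (htpyRep (f ≫ g)) (htpyRep f ≫ htpyRep g) (by
      rw [quotient_map_htpyRep, Functor.map_comp, quotient_map_htpyRep, quotient_map_htpyRep]
      rfl)).trans
    ((congrArg _ (truncCauMap_comp (htpyRep f) (htpyRep g))).trans
      ((eventuallyInvertible _).Q.map_comp _ _))

variable [IsRightCoherent A]

/-- The canonical morphism `σ_{≥ -n} X ⟶ X` in `K^{-,b}(proj A)`. -/
def truncKbι (X : KMinusB A) (n : ℕ) : (kbToKMinusB A).obj (truncKb X n) ⟶ X :=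
  ObjectProperty.homMk (brutalTruncHtpyι X.obj (-n))

lemma truncKb_map_truncKbι (X : KMinusB A) {n m : ℕ} (f : n ⟶ m) :
    (kbToKMinusB A).map ((truncCau X).obj.map f) ≫ truncKbι X m = truncKbι X n := by
  have := leOfHom f
  refine ObjectProperty.hom_ext _ ?_
  exact ((HomotopyCategory.quotient (ProjFG A) (.up ℤ)).map_comp _ _).symm.trans
    congr((HomotopyCategory.quotient (ProjFG A) (.up ℤ)).map
      $(brutalTruncMap_ι X.obj.as (show -(m : ℤ) ≤ -n by lia)))

instance : (dbInclusion A).Additive := by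
  dsimp only [dbInclusion]
  infer_instance

/-- The morphisms `Hom(-, σ_{≥ -n} X) ⟶ Hom(-, X)`, as a cocone. -/
def truncCocone (X : KMinusB A) :
    Cocone ((truncCau X).obj ⋙ preadditiveYoneda) where
  pt := (restriction (dbInclusion A) ⋙ ObjectProperty.ι _).obj ((kMinusBToDbMod A).obj X)
  ι :=
    { app := fun n => preadditiveYonedaMap (dbInclusion A) (truncKb X n) ≫
        Functor.whiskerLeft (dbInclusion A).op
          (preadditiveYoneda.map ((kMinusBToDbMod A).map (truncKbι X n)))
      naturality := fun n m f => by
        ext C t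
        change (dbInclusion A).map (t ≫ (truncCau X).obj.map f) ≫ _ = (dbInclusion A).map t ≫ _
        refine ((congrArg (· ≫ _) ((dbInclusion A).map_comp t ((truncCau X).obj.map f))).trans
          (Category.assoc _ _ _)).trans (congrArg ((dbInclusion A).map t ≫ ·) ?_)
        exact ((kMinusBToDbMod A).map_comp _ _).symm.trans
          (congrArg (kMinusBToDbMod A).map (truncKb_map_truncKbι X f)) }

lemma truncCocone_ι_app (X : KMinusB A) (n : ℕ) (C : (Kb (ProjFG A))ᵒᵖ)
    (t : C.unop ⟶ truncKb X n) :
    ((truncCocone X).ι.app n).app C t =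
      (kMinusBToDbMod A).map ((kbToKMinusB A).map t ≫ truncKbι X n) :=
  ((kMinusBToDbMod A).map_comp ((kbToKMinusB A).map t) (truncKbι X n)).symm

lemma bijective_truncCocone_ι_app (X : KMinusB A) (C : (Kb (ProjFG A))ᵒᵖ) :
    ∃ N : ℕ, ∀ n : ℕ, N ≤ n → Function.Bijective (((truncCocone X).ι.app n).app C) := by
  obtain ⟨N, hN⟩ := exists_bijective_comp_brutalTruncι C.unop X
  refine ⟨N, fun n hn => ⟨fun t₁ t₂ h => ?_, fun φ => ?_⟩⟩
  · have h' := (truncCocone_ι_app X n C t₁).symm.trans (h.trans (truncCocone_ι_app X n C t₂))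
    exact ObjectProperty.hom_ext _ ((hN n hn).1
      congr(($((kMinusBToDbMod A).map_injective h')).hom))
  · obtain ⟨φ, rfl⟩ := (kMinusBToDbMod A).map_surjective (X := (kbToKMinusB A).obj C.unop) φ
    obtain ⟨t, ht⟩ := (hN n hn).2 φ.hom
    let t' : C.unop ⟶ truncKb X n := ObjectProperty.homMk t
    exact ⟨t', (truncCocone_ι_app X n C t').trans
      (congrArg (kMinusBToDbMod A).map (ObjectProperty.hom_ext _ ht))⟩

/-- The functor `Hom(-, X)` on `K^b(proj A)` is the colimit of the `Hom(-, σ_{≥ -n} X)`: the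
colimit is eventually constant on each bounded complex. -/
def truncCoconeIsColimit (X : KMinusB A) : IsColimit (truncCocone X) := by
  refine evaluationJointlyReflectsColimits _ fun C => ?_
  choose N hN using bijective_truncCocone_ι_app X
  let G := ((truncCau X).obj ⋙ preadditiveYoneda) ⋙ (evaluation _ AddCommGrpCat.{u}).obj C
  let s := ((evaluation _ AddCommGrpCat.{u}).obj C).mapCocone (truncCocone X)
  have hs (n : ℕ) (hn : N C ≤ n) : IsIso (s.ι.app n) :=
    (ConcreteCategory.isIso_iff_bijective _).2 (hN C n hn)
  have := hs (N C) le_rfl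
  have hG : G.IsEventuallyConstantFrom (N C) := fun j f => by
    have := hs j (leOfHom f)
    have h : G.map f ≫ s.ι.app j = s.ι.app (N C) := s.w f
    have : IsIso (G.map f ≫ s.ι.app j) := by rw [h]; infer_instance
    exact IsIso.of_isIso_comp_right _ (s.ι.app j)
  exact hG.isColimitOfIsIso s

lemma truncCauMap_ι {X Y : KMinusB A} (f : X ⟶ Y) (n : ℕ) :
    (kbToKMinusB A).map ((truncCauMap (htpyRep f)).hom.app n) ≫ truncKbι Y n =
      truncKbι X n ≫ f := by
  refine ObjectProperty.hom_ext _ ?_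
  refine ((HomotopyCategory.quotient (ProjFG A) (.up ℤ)).map_comp _ _).symm.trans
    ((congrArg _ (brutalTruncFunctorMap_ι (htpyRep f) (-n))).trans
      (((HomotopyCategory.quotient (ProjFG A) (.up ℤ)).map_comp _ _).trans ?_))
  exact congrArg (brutalTruncHtpyι X.obj (-n) ≫ ·) (quotient_map_htpyRep f)

/-- The isomorphism `colim Hom(-, σ_{≥ -n} X) ≅ Hom(-, X)`. -/
def seqColimTruncCauIso (X : KMinusB A) : (seqColim _).obj (truncCau X).obj ≅
    (restriction (dbInclusion A) ⋙ ObjectProperty.ι _).obj ((kMinusBToDbMod A).obj X) :=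
  colimit.isoColimitCocone ⟨truncCocone X, truncCoconeIsColimit X⟩

lemma seqColimTruncCauIso_naturality {X Y : KMinusB A} (f : X ⟶ Y) :
    (seqColim _).map (truncCauMap (htpyRep f)).hom ≫ (seqColimTruncCauIso Y).hom =
      (seqColimTruncCauIso X).hom ≫
        (restriction (dbInclusion A) ⋙ ObjectProperty.ι _).map ((kMinusBToDbMod A).map f) := by
  have hι (Z : KMinusB A) (n : ℕ) : colimit.ι ((truncCau Z).obj ⋙ preadditiveYoneda) n ≫
      (seqColimTruncCauIso Z).hom = (truncCocone Z).ι.app n :=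
    colimit.isoColimitCocone_ι_hom ⟨truncCocone Z, truncCoconeIsColimit Z⟩ n
  have hα (n : ℕ) : colimit.ι ((truncCau X).obj ⋙ preadditiveYoneda) n ≫
      (seqColim _).map (truncCauMap (htpyRep f)).hom =
      preadditiveYoneda.map ((truncCauMap (htpyRep f)).hom.app n) ≫
        colimit.ι ((truncCau Y).obj ⋙ preadditiveYoneda) n :=
    ι_colimMap (Functor.whiskerRight (truncCauMap (htpyRep f)).hom preadditiveYoneda) n
  refine colimit.hom_ext fun n => ?_
  refine ((Category.assoc _ _ _).symm.trans ((congrArg (· ≫ _) (hα n)).trans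
    ((Category.assoc _ _ _).trans (congrArg (_ ≫ ·) (hι Y n))))).trans (Eq.trans ?_
      ((congrArg (· ≫ _) (hι X n)).symm.trans (Category.assoc _ _ _)))
  ext C t
  refine (truncCocone_ι_app Y n C (t ≫ (truncCauMap (htpyRep f)).hom.app n)).trans
    (Eq.trans ?_ (congrArg (· ≫ (kMinusBToDbMod A).map f) (truncCocone_ι_app X n C t)).symm)
  refine Eq.trans (congrArg (kMinusBToDbMod A).map ?_) ((kMinusBToDbMod A).map_comp _ _)
  exact (Category.assoc ((kbToKMinusB A).map t) _ _).trans
    ((congrArg (_ ≫ ·) (truncCauMap_ι f n)).trans (Category.assoc _ _ _).symm)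

variable (A) in
/-- The functor `K^{-,b}(proj A) ⥤ Ind_Cau K^b(proj A)` is compatible with the functors to the
category of presheaves of abelian groups on `K^b(proj A)`. -/
def kMinusBToIndCauCompIso : kMinusBToIndCau A ⋙ indCauToFunctor (Kb (ProjFG A)) ≅
    kMinusBToDbMod A ⋙ restriction (dbInclusion A) ⋙ ObjectProperty.ι _ :=
  NatIso.ofComponents
    (fun X => (qCompIndCauToFunctorIso (Kb (ProjFG A))).app (truncCau X) ≪≫ seqColimTruncCauIso X)
    (fun {X Y} f => by
      have h := (qCompIndCauToFunctorIso (Kb (ProjFG A))).hom.naturality (truncCauMap (htpyRep f))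
      refine (Category.assoc _ _ _).symm.trans ((congrArg (· ≫ _) h).trans ?_)
      refine (Category.assoc _ _ _).trans (Eq.trans ?_ (Category.assoc _ _ _).symm)
      exact congrArg (_ ≫ ·) (seqColimTruncCauIso_naturality f))

end Factorization

theorem isCauchySequentialPartialCompletion_dbInclusion (A : Type u) [Ring A] [IsRightCoherent A] :
    IsCauchySequentialPartialCompletion (dbInclusion A) where
  toIsPartialCompletion := isPartialCompletion_dbInclusion
  exists_factorization := ⟨(kMinusBToDbMod A).asEquivalence.inverse ⋙ kMinusBToIndCau A,
    ⟨Functor.associator _ _ _ ≪≫ Functor.isoWhiskerLeft _ (kMinusBToIndCauCompIso A) ≪≫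
      Functor.isoWhiskerRight (inverseCompRestrictionIso A) (ObjectProperty.ι _)⟩⟩

end

end PerfectCompletion

theorem mainTheorem1 (A : Type u) [Ring A] [PerfectCompletion.IsRightCoherent A] :
    PerfectCompletion.IsCauchySequentialPartialCompletion (PerfectCompletion.dbInclusion A) ∧
    (PerfectCompletion.kMinusBToDbMod A).IsEquivalence ∧
    (∀ (P : CochainComplex (PerfectCompletion.ProjFG A) ℤ)
      (hP : PerfectCompletion.IsBoundedAboveWithBoundedCohomology A P),
      PerfectCompletion.isCauchy _ (PerfectCompletion.brutalTruncSeqKb P hP.1) ∧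
      PerfectCompletion.IsHomotopyColimit (PerfectCompletion.truncCoconeKProj A P)) ∧
    (∀ (X Y : PerfectCompletion.KMinusB A)
      (f : (PerfectCompletion.toKProj A).obj X.obj ⟶ (PerfectCompletion.toKProj A).obj Y.obj),
      PerfectCompletion.IsPhantom f → f = 0) := by
  refine ⟨PerfectCompletion.isCauchySequentialPartialCompletion_dbInclusion A, inferInstance,
    fun P hP => ⟨PerfectCompletion.isCauchy_brutalTruncSeqKb P hP.1,
      PerfectCompletion.isHomotopyColimit_truncCoconeKProj P⟩,
    PerfectCompletion.eq_zero_of_isPhantom⟩
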